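/- **Setting.** Identify binary strings with natural numbers by $\epsilon\mapsto 0,\ 0\mapsto 1,\ 1\mapsto 2,\ 00\mapsto 3,\dots$, and for $k\in\mathbb N$ let $\log k$ denote the length of the string identified with $k$. Let $\Phi$ be an optimal universal prefix-free interpreter: a partial computable function $(p,y)\mapsto\Phi(p|y)$ from binary programs $p$ and conditions $y\in\mathbb N^{<\omega}$ to $\mathbb N^{<\omega}$, whose domain is prefix-free for every fixed $y$, such that for every other such function $V$ there is a string $w$ with $\Phi(wp|y)=V(p|y)$ for all $p,y$. Let $\Phi_t(p|y)$, computable in $t,p,y$, be the output of $\Phi(p|y)$ if the computation halts within time $t$ (undefined otherwise); a halting computation within time $t$ has a program of length $l(p)\le t$. For $x\in\{0,1\}^n$ put $$K(x|y,n)=\min\{l(p):\Phi(p|y,n)=x\},\qquad K_t(x|y,n)=\min\{l(p):\Phi_t(p|y,n)=x\}$$ (with $\min\emptyset=\infty$), and $K(x)=K(x|n)$, $K_t(x)=K_t(x|n)$: the length $n$ is always available. Let $$\Omega^n_t=\sum\{2^{-l(p)}:\Phi_t(p|n)\in\{0,1\}^n\},\qquad \Omega^n=\lim_{t\to\infty}\Omega^n_t,\qquad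 t_k=\min\{t:\Omega^n-\Omega^n_t\le 2^{-k}\},$$ let $\Omega^{n,j}$ be the string of the first $j$ bits of the binary expansion of $\Omega^n$, and, for a fixed constant $c\in\mathbb N$, let the computational $m$-depth of $x\in\{0,1\}^n$ be $$k_x=\min\{k\in\mathbb N:K_{t_k}(x)\le K(x)+c\}.$$ Let $H$ be the halting sequence, $H^n_i=1$ if $\Phi(i|n)$ is defined and $H^n_i=0$ otherwise. Let $K^H(x)$ be the complexity, given $n$, with respect to an optimal universal prefix-free interpreter $\Phi^H$ relative to the oracle $H$ (defined like $\Phi$, with "partial computable with oracle $H$" in place of "partial computable"), and let $I(x;H)=K(x)-K^H(x)$. **Proposition 3.3.** For all such $\Phi$, $\Phi^H$ and every $c\in\mathbb N$ there is a constant $C$ such that for all $n\in\mathbb N$ and all $x\in\{0,1\}^n$: 1. $x,K(x),k_x\longrightarrow\Omega^{n,k_x}$, that is, there is a program $p$ with $l(p)\le C$ and $\Phi(p\,|\,x,K(x),k_x,n)=\Omega^{n,k_x}$; 2. $\bigl|K(x|n)-\bigl(k_x+K(x|\Omega^{n,k_x},n)\bigr)\bigr|\le 2\log k_x+C$; 3.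 $I(x;H)\ge k_x-2\log k_x-C$. -/

import Mathlib

/-- The natural bijection between binary strings and natural numbers:
`ε ↦ 0, 0 ↦ 1, 1 ↦ 2, 00 ↦ 3, 01 ↦ 4, …` (`false` is the bit 0, `true` is the bit 1). -/
def strNum (x : List Bool) : ℕ :=
  x.foldl (fun a b => 2 * a + 1 + b.toNat) 0

/-- The logarithm rounded to an integer: the length of the binary string that corresponds to `k`
under `strNum`. -/
def natLen (k : ℕ) : ℕ := Nat.log 2 (k + 1)

/-- Finite sequences of natural numbers are the conditions and the outputs.  For every fixed
condition `y`, the set of all programs `p` on which `U` is defined is prefix-free. -/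
def IsPrefixFree (U : List Bool → List ℕ →. List ℕ) : Prop :=
  ∀ (y : List ℕ) (p q : List Bool), (U p y).Dom → (U q y).Dom → p <+: q → p = q

/-- `U` is an optimal universal prefix-free interpreter relative to the oracles in `O`: it is
partial computable in `O` and prefix-free, and it simulates every such interpreter `V` at the cost
of one fixed string `w` in front of the program. -/
def IsUniversal (O : Set (ℕ →. ℕ)) (U : List Bool → List ℕ →. List ℕ) : Prop :=
  RecursiveIn₂ O U ∧ IsPrefixFree U ∧
    ∀ V : List Bool → List ℕ →. List ℕ, RecursiveIn₂ O V → IsPrefixFree V →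
      ∃ w : List Bool, ∀ (p : List Bool) (y : List ℕ), U (w ++ p) y = V p y

/-- Prefix complexity of `x` given the condition `y`, with respect to `U`: the least length of a
program that outputs `x` given `y`. -/
noncomputable def complexity (U : List Bool → List ℕ →. List ℕ) (x y : List ℕ) : ℕ :=
  sInf {l : ℕ | ∃ p : List Bool, x ∈ U p y ∧ p.length = l}

/-- For a universal interpreter the set in `complexity` is non-empty, so that `complexity` is a
true minimum. -/
theorem IsUniversal.exists_program {O : Set (ℕ →. ℕ)} {U : List Bool → List ℕ →. List ℕ}
    (hU : IsUniversal O U) (x y : List ℕ) : ∃ p : List Bool, x ∈ U p y := by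
  let f : List Bool × List ℕ → Option (List ℕ) := fun a => if a.1 = [] then some x else none
  have hf : Computable f :=
    (Primrec.ite (PrimrecRel.comp Primrec.eq Primrec.fst (Primrec.const []))
      (Primrec.const _) (Primrec.const _)).to_comp
  let V : List Bool → List ℕ →. List ℕ := fun p y => (f (p, y) : Part (List ℕ))
  have hdom : ∀ p y, (V p y).Dom → p = [] := by
    intro p y h
    by_contra hp
    simp [V, f, hp] at h
  obtain ⟨w, hw⟩ := hU.2.2 V (Partrec.recursiveIn (Computable.ofOption hf))
    (fun y p q hp hq _ => by rw [hdom p y hp, hdom q y hq])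
  exact ⟨w ++ [], by rw [hw]; simp [V, f]⟩

/-- An interpreter with running times: `step t p y` is the output of the program `p` on the
condition `y` if it halts within time `t`, and `none` otherwise.  Within time `t` at most `t` bits
of the program can be read. -/
structure Interpreter where
  step : ℕ → List Bool → List ℕ → Option (List ℕ)
  computable_step : Computable fun a : ℕ × List Bool × List ℕ => step a.1 a.2.1 a.2.2
  step_mono : ∀ {s t : ℕ} {p : List Bool} {y z : List ℕ},
    s ≤ t → step s p y = some z → step t p y = some z
  length_le : ∀ {t : ℕ} {p : List Bool} {y z : List ℕ}, step t p y = some z → p.length ≤ t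

namespace Interpreter

/-- The partial function computed by the interpreter: the limit of `step t p y` in `t`. -/
def eval (Φ : Interpreter) (p : List Bool) : List ℕ →. List ℕ :=
  fun y => Nat.rfindOpt fun t => Φ.step t p y

theorem mem_eval (Φ : Interpreter) {p : List Bool} {y z : List ℕ} :
    z ∈ Φ.eval p y ↔ ∃ t, Φ.step t p y = some z :=
  Nat.rfindOpt_mono fun h h' => Φ.step_mono h h'

/-- `K_t(x | y)`: the least length of a program that outputs `x` given `y` within time `t`,
and `⊤` if there is none. -/
noncomputable def complexityWithin (Φ : Interpreter) (t : ℕ) (x y : List ℕ) : ℕ∞ :=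
  ⨅ p ∈ {p : List Bool | Φ.step t p y = some x}, (p.length : ℕ∞)

/-- The programs that, given `n`, output a binary string of length `n` within time `t`. -/
def programsWithin (Φ : Interpreter) (n t : ℕ) : Set (List Bool) :=
  {p | ∃ x : List Bool, x.length = n ∧ Φ.step t p [n] = some [strNum x]}

/-- `Ω^n_t`. -/
noncomputable def omegaWithin (Φ : Interpreter) (n t : ℕ) : ℝ :=
  ∑' p : Φ.programsWithin n t, (2 : ℝ)⁻¹ ^ (p : List Bool).length

theorem finite_programsWithin (Φ : Interpreter) (n t : ℕ) : (Φ.programsWithin n t).Finite :=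
  (List.finite_length_le Bool t).subset fun _ ⟨_, _, h⟩ => Φ.length_le h

theorem omegaWithin_mono (Φ : Interpreter) (n : ℕ) : Monotone (Φ.omegaWithin n) := by
  intro s t hst
  have hsub : Φ.programsWithin n s ⊆ Φ.programsWithin n t :=
    fun p ⟨x, hx, h⟩ => ⟨x, hx, Φ.step_mono hst h⟩
  have : Finite (Φ.programsWithin n s) := Φ.finite_programsWithin n s
  have : Finite (Φ.programsWithin n t) := Φ.finite_programsWithin n t
  exact Summable.tsum_le_tsum_of_inj (Set.inclusion hsub) (Set.inclusion_injective hsub)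
    (fun _ _ => by positivity) (fun _ => le_rfl) Summable.of_finite Summable.of_finite

/-- `Ω^n`, the limit of the sequence `Ω^n_t`, which is non-decreasing in `t`
(and bounded by `1` if `Φ` is prefix-free). -/
noncomputable def omega (Φ : Interpreter) (n : ℕ) : ℝ := ⨆ t, Φ.omegaWithin n t

/-- The supremum in `omega` is that of a bounded sequence if `Φ` is prefix-free. -/
theorem omegaWithin_le_one (Φ : Interpreter) (hΦ : IsPrefixFree Φ.eval) (n t : ℕ) :
    Φ.omegaWithin n t ≤ 1 := by
  have hpf : ∀ p q, p ∈ Φ.programsWithin n t → q ∈ Φ.programsWithin n t → p <+: q → p = q := by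
    rintro p q ⟨x, -, hx⟩ ⟨y, -, hy⟩ h
    exact hΦ [n] p q (Part.dom_iff_mem.2 ⟨_, Φ.mem_eval.2 ⟨t, hx⟩⟩)
      (Part.dom_iff_mem.2 ⟨_, Φ.mem_eval.2 ⟨t, hy⟩⟩) h
  have hfin := Φ.finite_programsWithin n t
  have hsum : Φ.omegaWithin n t = ∑ p ∈ hfin.toFinset, (2 : ℝ)⁻¹ ^ p.length := by
    unfold omegaWithin
    rw [← Finset.tsum_subtype' hfin.toFinset (fun p => (2 : ℝ)⁻¹ ^ p.length), hfin.coe_toFinset]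
  rw [hsum]
  by_cases h0 : [] ∈ Φ.programsWithin n t
  · have : hfin.toFinset = {[]} := by
      ext q
      simp only [Set.Finite.mem_toFinset, Finset.mem_singleton]
      exact ⟨fun hq => (hpf [] q h0 hq List.nil_prefix).symm, fun hq => hq ▸ h0⟩
    simp [this]
  · have hud : InformationTheory.UniquelyDecodable (hfin.toFinset : Set (List Bool)) := by
      rw [hfin.coe_toFinset]
      intro L₁
      induction L₁ with
      | nil =>
        intro L₂ _ h₂ h
        cases L₂ with
        | nil => rfl
        | cons b L =>
          simp only [List.flatten_nil, List.flatten_cons] at h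
          have := (List.append_eq_nil_iff.1 h.symm).1
          exact absurd (this ▸ h₂ b (by simp)) h0
      | cons a L ih =>
        intro L₂ h₁ h₂ h
        cases L₂ with
        | nil =>
          simp only [List.flatten_nil, List.flatten_cons] at h
          have := (List.append_eq_nil_iff.1 h).1
          exact absurd (this ▸ h₁ a (by simp)) h0
        | cons b M =>
          simp only [List.flatten_cons] at h
          have ha := h₁ a (by simp)
          have hb := h₂ b (by simp)
          have hab : a = b := by
            rcases List.prefix_or_prefix_of_prefix (List.prefix_append a L.flatten)
              (h ▸ List.prefix_append b M.flatten) with h' | h'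
            · exact hpf a b ha hb h'
            · exact (hpf b a hb ha h').symm
          subst hab
          rw [ih M (fun w hw => h₁ w (by simp [hw])) (fun w hw => h₂ w (by simp [hw]))
            (List.append_cancel_left h)]
    simpa using InformationTheory.kraft_mcmillan_inequality hud

/-- `Ω^{n,j}`: the first `j` bits of the binary expansion of `Ω^n`. -/
noncomputable def omegaBits (Φ : Interpreter) (n j : ℕ) : List Bool :=
  (List.range j).map fun i => decide (Real.digits (Φ.omega n) 2 i = 1)

/-- `t_k` for length `n`: the least time `t` with `Ω^n - Ω^n_t ≤ 2^{-k}`. -/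
noncomputable def omegaTime (Φ : Interpreter) (n k : ℕ) : ℕ :=
  sInf {t : ℕ | Φ.omega n - Φ.omegaWithin n t ≤ (2 : ℝ)⁻¹ ^ k}

/-- The complexity `K(x)` of a binary string, conditional to its length. -/
noncomputable def K (Φ : Interpreter) (x : List Bool) : ℕ :=
  complexity Φ.eval [strNum x] [x.length]

/-- The computational `m`-depth `k_x` of `x`, where equality of `K_{t_k}(x)` and `K(x)` is
understood up to the constant `c`. -/
noncomputable def depth (Φ : Interpreter) (c : ℕ) (x : List Bool) : ℕ :=
  sInf {k : ℕ | Φ.complexityWithin (Φ.omegaTime x.length k) [strNum x] [x.length] ≤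
    (Φ.K x : ℕ∞) + (c : ℕ∞)}

/-- The set in `omegaTime` is non-empty. -/
theorem exists_omegaTime (Φ : Interpreter) (n k : ℕ) :
    ∃ t, Φ.omega n - Φ.omegaWithin n t ≤ (2 : ℝ)⁻¹ ^ k := by
  obtain ⟨t, ht⟩ := exists_lt_of_lt_ciSup
    (show Φ.omega n - (2 : ℝ)⁻¹ ^ k < ⨆ t, Φ.omegaWithin n t from sub_lt_self _ (by positivity))
  exact ⟨t, by linarith⟩

/-- The set in `depth` is non-empty if `Φ` is universal. -/
theorem exists_depth (Φ : Interpreter) (hΦ : IsUniversal ∅ Φ.eval) (c : ℕ) (x : List Bool) :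
    ∃ k, Φ.complexityWithin (Φ.omegaTime x.length k) [strNum x] [x.length] ≤
      (Φ.K x : ℕ∞) + (c : ℕ∞) := by
  obtain ⟨p, hp, hl⟩ : ∃ p : List Bool, [strNum x] ∈ Φ.eval p [x.length] ∧ p.length = Φ.K x :=
    Nat.sInf_mem (s := {l : ℕ | ∃ p, [strNum x] ∈ Φ.eval p [x.length] ∧ p.length = l})
      (let ⟨p, hp⟩ := hΦ.exists_program _ _; ⟨_, p, hp, rfl⟩)
  refine ⟨p.length + 1, le_trans ?_ le_self_add⟩
  set n := x.length with hn
  set t := Φ.omegaTime n (p.length + 1) with ht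
  have htk : Φ.omega n - Φ.omegaWithin n t ≤ (2 : ℝ)⁻¹ ^ (p.length + 1) :=
    Nat.sInf_mem (Φ.exists_omegaTime n (p.length + 1))
  obtain ⟨s, hs⟩ := Φ.mem_eval.1 hp
  suffices h : Φ.step t p [n] = some [strNum x] by
    exact (iInf₂_le p h).trans (by rw [hl])
  rcases le_total s t with hst | hst
  · exact Φ.step_mono hst hs
  by_contra hne
  have hmem : p ∉ Φ.programsWithin n t := by
    rintro ⟨y, hy, h⟩
    exact hne (by rw [h, ← Φ.step_mono hst h, hs])
  have hins : insert p (Φ.programsWithin n t) ⊆ Φ.programsWithin n s := by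
    rintro q (rfl | ⟨y, hy, h⟩)
    · exact ⟨x, rfl, hs⟩
    · exact ⟨y, hy, Φ.step_mono hst h⟩
  have hle : ∀ r, Φ.omegaWithin n r = ∑ q ∈ (Φ.finite_programsWithin n r).toFinset,
      (2 : ℝ)⁻¹ ^ q.length := by
    intro r
    unfold omegaWithin
    rw [← Finset.tsum_subtype' _ (fun p : List Bool => (2 : ℝ)⁻¹ ^ p.length),
      Set.Finite.coe_toFinset]
  have h1 : Φ.omegaWithin n t + (2 : ℝ)⁻¹ ^ p.length ≤ Φ.omegaWithin n s := by
    rw [hle, hle, add_comm,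
      ← Finset.sum_insert (f := fun q : List Bool => (2 : ℝ)⁻¹ ^ q.length)
        (s := (Φ.finite_programsWithin n t).toFinset) (a := p) (by simpa using hmem)]
    refine Finset.sum_le_sum_of_subset_of_nonneg ?_ (fun _ _ _ => by positivity)
    intro q hq
    simp only [Finset.mem_insert, Set.Finite.mem_toFinset] at hq ⊢
    exact hins hq
  have h2 : Φ.omegaWithin n s ≤ Φ.omega n :=
    le_ciSup (f := Φ.omegaWithin n) ⟨1, by rintro _ ⟨r, rfl⟩; exact Φ.omegaWithin_le_one hΦ.2.1 n r⟩ s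
  have h3 : (0 : ℝ) < (2 : ℝ)⁻¹ ^ p.length := by positivity
  rw [pow_succ] at htk
  linarith

open Classical in
/-- The halting sequence `H^n_i`, as a function of the pair `(n, i)`: it is `1` if `Φ` halts on
(the string with number) `i` given `n`, and `0` otherwise. -/
noncomputable def halting (Φ : Interpreter) (m : ℕ) : ℕ :=
  if ∃ p : List Bool, strNum p = m.unpair.2 ∧ (Φ.eval p [m.unpair.1]).Dom then 1 else 0

/-- `I(x; H) = K(x) - K^H(x)`, where `K^H` is the complexity with respect to `ΦH`. -/
noncomputable def haltingInfo (Φ : Interpreter) (ΦH : List Bool → List ℕ →. List ℕ)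
    (x : List Bool) : ℤ :=
  (Φ.K x : ℤ) - (complexity ΦH [strNum x] [x.length] : ℤ)

/-- `a ⟶ b` in the presence of `n`, with a program of length at most `C`. -/
def Computes (Φ : Interpreter) (C n : ℕ) (a b : List ℕ) : Prop :=
  ∃ p : List Bool, p.length ≤ C ∧ b ∈ Φ.eval p (a ++ [n])

end Interpreter

/-! ### Closure properties of computable functions and predicates -/

section Computability

variable {α β σ : Type*} [Primcodable α] [Primcodable β] [Primcodable σ]

/-! Everything rests on one saving. If `Ω^n` is known up to `2^{-k}`, say `m ≤ 2^k Ω^n ≤ m + 1`, one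
can wait until `Ω^n_s ≥ (m - 2)/2^k`; the programs that halt later weigh at most `3 · 2^{-k}`
together. Their weights, multiplied by `2^k/4`, form an admissible set of Kraft–Chaitin requests
(`IsUniversal.exists_complexity_le_request`), so a late program of length `l` can be replaced by one
of length `l - k + O(1)`, given `n, k, m` (`exists_complexity_add_le_length`). Now let `k` be the
depth of `x`. If `k > 0`, no program of length at most `K(x) + c` prints `x` by time `t_{k-1}`, when
at most `2 · 2^{-k}` of `Ω^n` is missing. Such a program is therefore late, and `k + K(x | n, k, m)
≤ K(x) + O(1)` (`exists_complexity_add_depth_le`).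

Claim 2: `Ω^{n,k}` yields `m`, which gives one inequality; for the other, `Ω^{n,k}` is written in
front of a program, after a self-delimiting code of `k` with `2 log k + 1` bits.

Claim 3: `H` decides whether some `Ω^n_t` reaches `j/2^k`, and so yields `m` from `n` and `k`; only
the code of `k` has to be supplied.

Claim 1: given `x, K(x), k`, search for the first time `t` at which a program of length at most
`K(x) + c` prints `x`. Minimality of the depth forces `t ≥ t_{k-1}`, so the integer parts of `2^k
Ω^n_t` and `2^k Ω^n` differ by at most 2, and one of three fixed programs adds the right correction.
-/

theorem Computable.ite {c : α → Prop} [DecidablePred c] {f g : α → σ} (hc : ComputablePred c)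
    (hf : Computable f) (hg : Computable g) : Computable fun a => if c a then f a else g a :=
  (Computable.cond hc.decide hf hg).of_eq fun a => by by_cases h : c a <;> simp [h]

theorem Computable.computablePred_eq [DecidableEq σ] {f g : α → σ} (hf : Computable f)
    (hg : Computable g) : ComputablePred fun a => f a = g a :=
  Computable.computablePred (Primrec.eq.decide.to_comp.comp hf hg)

theorem Computable.computablePred_le {f g : α → ℕ} (hf : Computable f)
    (hg : Computable g) : ComputablePred fun a => f a ≤ g a :=
  Computable.computablePred (Primrec.nat_le.decide.to_comp.comp hf hg)

theorem ComputablePred.comp' {p : β → Prop} {g : α → β} (hp : ComputablePred p)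
    (hg : Computable g) : ComputablePred fun a => p (g a) := by
  classical
  exact Computable.computablePred (hp.decide.comp hg)

theorem ComputablePred.and' {p q : α → Prop} (hp : ComputablePred p)
    (hq : ComputablePred q) : ComputablePred fun a => p a ∧ q a := by
  classical
  exact Computable.computablePred ((Primrec.and.to_comp.comp hp.decide hq.decide).of_eq
    fun a => by simp)

theorem Computable.nat_add {f g : α → ℕ} (hf : Computable f) (hg : Computable g) :
    Computable fun a => f a + g a := Primrec.nat_add.to_comp.comp hf hg

theorem Computable.nat_sub {f g : α → ℕ} (hf : Computable f) (hg : Computable g) :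
    Computable fun a => f a - g a := Primrec.nat_sub.to_comp.comp hf hg

theorem Computable.nat_mul {f g : α → ℕ} (hf : Computable f) (hg : Computable g) :
    Computable fun a => f a * g a := Primrec.nat_mul.to_comp.comp hf hg

theorem Computable.nat_div {f g : α → ℕ} (hf : Computable f) (hg : Computable g) :
    Computable fun a => f a / g a := Primrec.nat_div.to_comp.comp hf hg

theorem Computable.nat_mod {f g : α → ℕ} (hf : Computable f) (hg : Computable g) :
    Computable fun a => f a % g a := Primrec.nat_mod.to_comp.comp hf hg

theorem Primrec.two_pow : Primrec fun n : ℕ => 2 ^ n :=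
  (Primrec.nat_rec₁ (f := fun _ r => 2 * r) 1
    (Primrec.nat_mul.comp (Primrec.const 2) Primrec.snd).to₂).of_eq fun n => by
      induction n with
      | zero => rfl
      | succ n ih => rw [pow_succ', ← ih]

theorem Computable.two_pow {f : α → ℕ} (hf : Computable f) : Computable fun a => 2 ^ f a :=
  Primrec.two_pow.to_comp.comp hf

theorem Computable.sum_range {N : α → ℕ} {f : α → ℕ → ℕ} (hN : Computable N)
    (hf : Computable₂ f) : Computable fun a => ∑ i ∈ Finset.range (N a), f a i :=
  (Computable.nat_rec (g := fun _ => 0) (h := fun a p => p.2 + f a p.1) hN (Computable.const 0)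
    (Computable.nat_add (Computable.snd.comp Computable.snd)
      (hf.comp Computable.fst (Computable.fst.comp Computable.snd))).to₂).of_eq fun a => by
        induction N a with
        | zero => rfl
        | succ n ih => rw [Finset.sum_range_succ, ← ih]

theorem Computable.singleton {f : α → σ} (hf : Computable f) : Computable fun a => [f a] :=
  Computable.list_cons.comp hf (Computable.const [])

theorem ComputablePred.exists_lt {N : α → ℕ} {p : α → ℕ → Prop} (hN : Computable N)
    (hp : ComputablePred fun a : α × ℕ => p a.1 a.2) :
    ComputablePred fun a => ∃ i < N a, p a i := by
  classical
  have h := Computable.sum_range (f := fun a i => if p a i then 1 else 0) hN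
    (Computable.ite hp (Computable.const 1) (Computable.const 0)).to₂
  refine (Computable.computablePred_le (Computable.const 1) h).of_eq fun a => ?_
  rw [Nat.one_le_iff_ne_zero, Ne, Finset.sum_eq_zero_iff]
  simp

theorem Nat.log_eq_findGreatest (n : ℕ) :
    Nat.log 2 n = n.findGreatest fun k => 2 ^ k ≤ n := by
  rcases Nat.eq_zero_or_pos n with rfl | hn
  · rfl
  symm
  rw [Nat.findGreatest_eq_iff]
  refine ⟨Nat.log_le_self 2 n, fun _ => Nat.pow_log_le_self 2 hn.ne', fun {k} hk _ h => ?_⟩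
  exact absurd (Nat.le_log_of_pow_le one_lt_two h) (by omega)

theorem Primrec.natLen : Primrec natLen := by
  have h : PrimrecRel fun n k : ℕ => 2 ^ k ≤ n :=
    Primrec.nat_le.comp (Primrec.two_pow.comp Primrec.snd) Primrec.fst
  have := (Primrec.nat_findGreatest (f := fun n => n) Primrec.id h).of_eq
    fun n => (Nat.log_eq_findGreatest n).symm
  exact this.comp Primrec.succ

theorem Primrec.strNum : Primrec strNum := by
  have hb : Primrec Bool.toNat := Primrec.dom_bool _
  refine Primrec.list_foldl (f := fun x : List Bool => x) (g := fun _ => 0)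
    (h := fun _ p => 2 * p.1 + 1 + p.2.toNat) Primrec.id (Primrec.const 0) ?_
  exact Primrec.nat_add.comp (Primrec.succ.comp (Primrec.nat_mul.comp (Primrec.const 2)
    (Primrec.fst.comp Primrec.snd))) (hb.comp (Primrec.snd.comp Primrec.snd))

end Computability

/-! ### Strings and their numbers -/

section Strings

theorem strNum_concat (x : List Bool) (b : Bool) :
    strNum (x ++ [b]) = 2 * strNum x + 1 + b.toNat := by
  simp [strNum]

/-- The binary expansion of `strNum x + 1` is a leading 1 followed by `x`; appending `y` shifts it
by `y.length` places and fills them. -/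
theorem strNum_append_bounds (x y : List Bool) :
    (strNum x + 1) * 2 ^ y.length ≤ strNum (x ++ y) + 1 ∧
      strNum (x ++ y) + 1 < (strNum x + 2) * 2 ^ y.length := by
  induction y using List.reverseRecOn with
  | nil => simp
  | append_singleton y b ih =>
    rw [← List.append_assoc, strNum_concat, List.length_append, List.length_singleton, pow_succ]
    have : b.toNat ≤ 1 := Bool.toNat_le b
    constructor
    · nlinarith [ih.1]
    · have := ih.2
      have h : strNum (x ++ y) + 2 ≤ (strNum x + 2) * 2 ^ y.length := this
      nlinarith

theorem two_pow_le_strNum (x : List Bool) : 2 ^ x.length ≤ strNum x + 1 := by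
  simpa [strNum] using (strNum_append_bounds [] x).1

theorem strNum_lt_two_pow (x : List Bool) : strNum x + 1 < 2 ^ (x.length + 1) := by
  have := (strNum_append_bounds [] x).2
  rw [pow_succ']
  simpa [strNum] using this

theorem natLen_strNum (x : List Bool) : natLen (strNum x) = x.length :=
  Nat.log_eq_of_pow_le_of_lt_pow (two_pow_le_strNum x) (strNum_lt_two_pow x)

theorem strNum_map_range {f : ℕ → Bool} {F : ℕ → ℕ} {k : ℕ} (h0 : F 0 = 1)
    (hF : ∀ j < k, F (j + 1) = 2 * F j + (f j).toNat) :
    strNum ((List.range k).map f) + 1 = F k := by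
  induction k with
  | zero => simp [strNum, h0]
  | succ k ih =>
    rw [List.range_succ, List.map_append, List.map_singleton, strNum_concat, hF k (by omega),
      ← ih fun j hj => hF j (by omega)]
    ring

/-- The binary string with number `i`. -/
def numStr (i : ℕ) : List Bool :=
  (List.range (natLen i)).map fun j => decide ((i + 1) / 2 ^ (natLen i - (j + 1)) % 2 = 1)

theorem strNum_numStr (i : ℕ) : strNum (numStr i) = i := by
  suffices h : strNum (numStr i) + 1 = i + 1 by omega
  rw [numStr, strNum_map_range (F := fun j => (i + 1) / 2 ^ (natLen i - j))]
  · simp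
  · have h1 : 2 ^ natLen i ≤ i + 1 := Nat.pow_log_le_self 2 (Nat.succ_ne_zero i)
    have h2 : i + 1 < 2 ^ (natLen i + 1) := Nat.lt_pow_succ_log_self one_lt_two _
    rw [pow_succ] at h2
    rw [Nat.sub_zero]
    exact Nat.div_eq_of_lt_le (by omega) (by omega)
  · intro j hj
    have e : natLen i - j = natLen i - (j + 1) + 1 := by omega
    rw [e, pow_succ, ← Nat.div_div_eq_div_mul]
    generalize (i + 1) / 2 ^ (natLen i - (j + 1)) = a
    have : (decide (a % 2 = 1)).toNat = a % 2 := by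
      rcases Nat.mod_two_eq_zero_or_one a with h | h <;> simp [h]
    rw [this]
    omega

theorem length_numStr (i : ℕ) : (numStr i).length = natLen i := by simp [numStr]

theorem strNum_injective : Function.Injective strNum := by
  intro x
  induction x using List.reverseRecOn with
  | nil =>
    intro y h
    have := natLen_strNum y
    rw [← h, natLen_strNum] at this
    exact (List.length_eq_zero_iff.1 this.symm).symm
  | append_singleton x b ih =>
    intro y h
    rcases List.eq_nil_or_concat y with rfl | ⟨y, c, rfl⟩
    · have := natLen_strNum (x ++ [b])
      rw [h, natLen_strNum] at this
      simp at this
    · rw [List.concat_eq_append] at h ⊢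
      rw [strNum_concat, strNum_concat] at h
      have hb : b.toNat = c.toNat := by
        have := Bool.toNat_le b
        have := Bool.toNat_le c
        omega
      have hbc : b = c := by cases b <;> cases c <;> simp_all
      rw [ih (show strNum x = strNum y by omega), hbc]

theorem numStr_strNum (x : List Bool) : numStr (strNum x) = x :=
  strNum_injective (strNum_numStr _)

theorem natLen_le_iff {i l : ℕ} : natLen i ≤ l ↔ i < 2 ^ (l + 1) - 1 := by
  rw [natLen, ← Nat.lt_succ_iff, Nat.log_lt_iff_lt_pow one_lt_two (Nat.succ_ne_zero i)]
  simp only [Nat.succ_eq_add_one]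
  omega

theorem Primrec.numStr : Primrec numStr := by
  refine Primrec.list_map (f := fun i => List.range (_root_.natLen i))
    (Primrec.list_range.comp Primrec.natLen) ?_
  refine PrimrecPred.decide ?_
  refine Primrec.eq.comp (Primrec.nat_mod.comp (Primrec.nat_div.comp
    (Primrec.succ.comp Primrec.fst) (Primrec.two_pow.comp (Primrec.nat_sub.comp
    (Primrec.natLen.comp Primrec.fst) (Primrec.succ.comp Primrec.snd)))) (Primrec.const 2))
    (Primrec.const 1)

end Strings

/-! ### Composition of functions computable with an oracle -/

section RecursiveIn

variable {α β γ σ : Type*} [Primcodable α] [Primcodable β] [Primcodable γ] [Primcodable σ]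
  {O : Set (ℕ →. ℕ)}

theorem RecursiveIn.bind' {f : α →. β} {g : β →. σ} (hf : RecursiveIn O f)
    (hg : RecursiveIn O g) : RecursiveIn O fun a => (f a).bind g := by
  refine (Nat.RecursiveIn.comp hg hf).of_eq fun n => ?_
  simp only [Part.bind_eq_bind, Part.bind_assoc, Part.bind_map]
  cases (Encodable.decode n : Option α) with
  | none => simp
  | some a =>
    simp only [Part.coe_some, Part.bind_some, Encodable.encodek]
    exact (Part.map_bind _ _ _).symm

theorem RecursiveIn.map_pair {f : α →. β} {h : α → γ} (hf : RecursiveIn O f)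
    (hh : Computable h) : RecursiveIn O fun a => (f a).map (Prod.mk (h a)) := by
  have hh' : RecursiveIn O (h : α →. γ) := hh.partrec.recursiveIn
  refine (Nat.RecursiveIn.pair hh' hf).of_eq fun n => ?_
  cases hd : (Encodable.decode n : Option α) with
  | none => simp [Seq.seq]
  | some a =>
    ext x
    simp [Seq.seq, Part.bind_some, eq_comm]

theorem RecursiveIn.comp' {f : β →. σ} {g : α → β} (hf : RecursiveIn O f)
    (hg : Computable g) : RecursiveIn O fun a => f (g a) :=
  (RecursiveIn.bind' (f := (g : α →. β)) hg.partrec.recursiveIn hf).of_eq fun _ =>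
    Part.bind_some _ _

end RecursiveIn

/-! ### Universal interpreters: headers, constant programs, Kraft–Chaitin -/

section Universal

variable {O : Set (ℕ →. ℕ)} {U Φ : List Bool → List ℕ →. List ℕ}

theorem complexity_le {p : List Bool} {x y : List ℕ} (h : x ∈ U p y) :
    complexity U x y ≤ p.length := Nat.sInf_le ⟨p, h, rfl⟩

theorem IsUniversal.exists_shortest (hU : IsUniversal O U) (x y : List ℕ) :
    ∃ p, x ∈ U p y ∧ p.length = complexity U x y :=
  Nat.sInf_mem (s := {l : ℕ | ∃ p : List Bool, x ∈ U p y ∧ p.length = l})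
    (let ⟨p, hp⟩ := hU.exists_program x y; ⟨_, p, hp, rfl⟩)

theorem IsUniversal.partrec (hU : IsUniversal ∅ U) :
    Partrec fun a : List Bool × List ℕ => U a.1 a.2 := recursiveIn_empty_iff.1 hU.1

/-- A program is preceded by a self-delimiting header that carries information about the
condition. -/
theorem IsUniversal.exists_complexity_le_header (hU : IsUniversal O U) (hΦ : IsUniversal ∅ Φ)
    {parse : List Bool → Option (ℕ × List Bool)} (hp : Computable parse)
    (hext : ∀ p a q r, parse p = some (a, q) → parse (p ++ r) = some (a, q ++ r))
    {f : ℕ × List ℕ →. List ℕ} (hf : RecursiveIn O f) :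
    ∃ C, ∀ h a y y' z, (∀ q, parse (h ++ q) = some (a, q)) → y' ∈ f (a, y) →
      complexity U z y ≤ h.length + complexity Φ z y' + C := by
  let V : List Bool → List ℕ →. List ℕ := fun p y =>
    (parse p : Part (ℕ × List Bool)).bind fun a => (f (a.1, y)).bind fun y' => Φ a.2 y'
  have hV : RecursiveIn₂ O V := by
    have h1 : RecursiveIn O fun b : List Bool × List ℕ =>
        (((parse b.1).map fun a => (a.2, a.1, b.2) : Option (List Bool × ℕ × List ℕ)) :
          Part (List Bool × ℕ × List ℕ)) := by
      refine Partrec.recursiveIn (Computable.ofOption ?_)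
      refine Computable.option_map (hp.comp Computable.fst) ?_
      exact Computable.pair (Computable.snd.comp Computable.snd)
        (Computable.pair (Computable.fst.comp Computable.snd)
          (Computable.snd.comp Computable.fst))
    have h2 : RecursiveIn O fun b : List Bool × ℕ × List ℕ => (f b.2).map (Prod.mk b.1) :=
      (hf.comp' Computable.snd).map_pair Computable.fst
    have h3 : RecursiveIn O fun b : List Bool × List ℕ => Φ b.1 b.2 := hΦ.partrec.recursiveIn
    refine ((h1.bind' h2).bind' h3).of_eq fun b => ?_
    simp only [V]
    cases parse b.1 with
    | none => simp
    | some a => simp [Part.bind_map]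
  -- A successful parse survives extension, so a program and its extension share the value `a` and
  -- hence the condition `y'`, for which `Φ` is prefix-free.
  have hV' : IsPrefixFree V := by
    rintro y p _ hd1 hd2 ⟨r, rfl⟩
    obtain ⟨z, hz⟩ := Part.dom_iff_mem.1 hd1
    obtain ⟨z', hz'⟩ := Part.dom_iff_mem.1 hd2
    simp only [V, Part.mem_bind_iff, Part.mem_ofOption, Option.mem_def] at hz hz'
    obtain ⟨a, ha, y1, hy1, hz⟩ := hz
    obtain ⟨a', ha', y2, hy2, hz'⟩ := hz'
    rw [hext p a.1 a.2 r ha] at ha'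
    obtain rfl := Option.some_injective _ ha'
    obtain rfl := Part.mem_unique hy1 hy2
    have h := hΦ.2.1 y1 _ _ (Part.dom_iff_mem.2 ⟨_, hz⟩) (Part.dom_iff_mem.2 ⟨_, hz'⟩)
      (List.prefix_append _ _)
    rw [List.self_eq_append_right.1 h, List.append_nil]
  obtain ⟨w, hw⟩ := hU.2.2 V hV hV'
  refine ⟨w.length, fun h a y y' z hh hy' => ?_⟩
  obtain ⟨q, hq, hl⟩ := hΦ.exists_shortest z y'
  have : z ∈ U (w ++ (h ++ q)) y := by
    rw [hw]
    simp only [V, Part.mem_bind_iff, Part.mem_ofOption, Option.mem_def]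
    exact ⟨_, hh q, y', hy', hq⟩
  refine (complexity_le this).trans ?_
  simp only [List.length_append]
  omega

/-- Transforming the condition by a partial computable function costs a constant. -/
theorem IsUniversal.exists_complexity_le_comp (hΦ : IsUniversal ∅ Φ) {f : List ℕ →. List ℕ}
    (hf : Partrec f) :
    ∃ C, ∀ y y' z, y' ∈ f y → complexity Φ z y ≤ complexity Φ z y' + C := by
  obtain ⟨C, hC⟩ := hΦ.exists_complexity_le_header hΦ (parse := fun p => some (0, p))
    (Computable.option_some.comp (Computable.pair (Computable.const 0) Computable.id))
    (by rintro p a q r ⟨⟩; rfl) (f := fun a => f a.2) (hf.comp Computable.snd).recursiveIn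
  exact ⟨C, fun y y' z h => by simpa using hC [] 0 y y' z (fun q => rfl) h⟩

/-- The values of a partial computable function have programs of constant length. -/
theorem IsUniversal.exists_program_le (hΦ : IsUniversal ∅ Φ) {f : List ℕ →. List ℕ}
    (hf : Partrec f) : ∃ C, ∀ y z, z ∈ f y → ∃ p : List Bool, p.length ≤ C ∧ z ∈ Φ p y := by
  -- Only the empty program is accepted, so the simulation prefix `w` is itself the required
  -- program.
  let V : List Bool → List ℕ →. List ℕ := fun p y =>
    ((if p = [] then some y else none : Option (List ℕ)) : Part (List ℕ)).bind f
  have hV : RecursiveIn₂ ∅ V := by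
    refine RecursiveIn.bind' (Partrec.recursiveIn (Computable.ofOption ?_)) hf.recursiveIn
    exact Computable.ite (Computable.computablePred_eq Computable.fst (Computable.const []))
      (Computable.option_some.comp Computable.snd) (Computable.const none)
  have hdom : ∀ p y, (V p y).Dom → p = [] := by
    intro p y h
    by_contra hp
    have h' : (Part.none.bind f).Dom := by simpa [V, hp] using h
    rw [show Part.none.bind f = Part.none from Part.bind_none f] at h'
    exact h'
  obtain ⟨w, hw⟩ := hΦ.2.2 V hV fun y p q h1 h2 _ => by rw [hdom p y h1, hdom q y h2]
  refine ⟨w.length, fun y z hz => ⟨w ++ [], by simp, ?_⟩⟩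
  rw [hw]
  have : V [] y = f y := by
    simp only [V, if_true]
    exact Part.bind_some _ _
  rwa [this]

/-- The weight `2^{-l}` of a request for a description of length `l`. -/
noncomputable def requestWeight (o : Option (ℕ × List ℕ)) : ℝ :=
  o.elim 0 fun a => (2 : ℝ)⁻¹ ^ a.1

theorem requestWeight_nonneg (o : Option (ℕ × List ℕ)) : 0 ≤ requestWeight o := by
  cases o <;> simp [requestWeight]

/-- The quotient is `c = ⌈S · 2^(l+1)⌉`. Thus an interval of length `2^{-l}` starting anywhere
contains a dyadic interval of half that length, at the price of one bit. -/
theorem Real.natCeil_scale_bounds {A m l : ℕ} {S : ℝ} (hS : S = A / 2 ^ m) :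
    S ≤ (((A * 2 ^ (l + 1) + 2 ^ m - 1) / 2 ^ m : ℕ) : ℝ) / 2 ^ (l + 1) ∧
      ((((A * 2 ^ (l + 1) + 2 ^ m - 1) / 2 ^ m : ℕ) : ℝ) + 1) / 2 ^ (l + 1) ≤
        S + (2 : ℝ)⁻¹ ^ l := by
  have h2 : 0 < 2 ^ m := by positivity
  set c := (A * 2 ^ (l + 1) + 2 ^ m - 1) / 2 ^ m with hc
  have h3 : A * 2 ^ (l + 1) ≤ c * 2 ^ m := by
    have := Nat.lt_div_mul_add h2 (a := A * 2 ^ (l + 1) + 2 ^ m - 1)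
    rw [← hc] at this
    omega
  have h4 : c * 2 ^ m ≤ A * 2 ^ (l + 1) + 2 ^ m := by
    have := Nat.div_mul_le_self (A * 2 ^ (l + 1) + 2 ^ m - 1) (2 ^ m)
    rw [← hc] at this
    omega
  have h3' : (A : ℝ) * 2 ^ (l + 1) ≤ c * 2 ^ m := by exact_mod_cast h3
  have h4' : (c : ℝ) * 2 ^ m ≤ A * 2 ^ (l + 1) + 2 ^ m := by exact_mod_cast h4
  subst hS
  constructor
  · rw [div_le_div_iff₀ (by positivity) (by positivity)]
    exact h3'
  · rw [inv_pow, div_add' _ _ _ (by positivity), div_le_div_iff₀ (by positivity) (by positivity),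
      pow_succ]
    rw [pow_succ] at h4'
    field_simp
    nlinarith

/-- Requests `(l, z)` for a description of `z` of length `l` that are enumerated uniformly in the
condition are met, up to a constant, as long as their total weight is at most `1`. -/
theorem IsUniversal.exists_complexity_le_request (hΦ : IsUniversal ∅ Φ) (d : ℕ)
    {g : ℕ → List ℕ → Option (ℕ × List ℕ)} (hg : Computable₂ g)
    (hl : ∀ u y l z, g u y = some (l, z) → l ≤ u + d) :
    ∃ C, ∀ y u l z, g u y = some (l, z) →
      ∑ i ∈ Finset.range (u + 1), requestWeight (g i y) ≤ 1 → complexity Φ z y ≤ l + C := by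
  -- Numerator of the weight `S u y` of the requests before `u`, over the denominator `2^(u + d)`;
  -- by `hl` the subtraction in the exponent is not truncated.
  let A : ℕ → List ℕ → ℕ := fun u y =>
    ∑ i ∈ Finset.range u, (g i y).elim 0 fun a => 2 ^ (u + d - a.1)
  let S : ℕ → List ℕ → ℝ := fun u y => ∑ i ∈ Finset.range u, requestWeight (g i y)
  -- Request `u` owns the interval from `S u y` to `S u y + 2^{-l}`; the dyadic interval from
  -- `c/2^(l+1)` to `(c+1)/2^(l+1)` inside it becomes its codeword.
  let c : ℕ → List ℕ → ℕ → ℕ := fun u y l => (A u y * 2 ^ (l + 1) + 2 ^ (u + d) - 1) / 2 ^ (u + d)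
  have hSA : ∀ u y, S u y = A u y / 2 ^ (u + d) := by
    intro u y
    simp only [S, A, Nat.cast_sum, Finset.sum_div]
    refine Finset.sum_congr rfl fun i hi => ?_
    cases h : g i y with
    | none => simp [requestWeight]
    | some a =>
      have h1 := hl i y a.1 a.2 h
      have h2 := Finset.mem_range.1 hi
      simp only [requestWeight, Option.elim, Nat.cast_pow, Nat.cast_ofNat]
      rw [inv_pow, pow_sub₀ (2 : ℝ) two_ne_zero (by omega)]
      field_simp
  have hSmono : ∀ y, Monotone fun u => S u y := fun y => monotone_nat_of_le_succ fun u => by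
    simp only [S]
    rw [Finset.sum_range_succ]
    linarith [requestWeight_nonneg (g u y)]
  have hSsucc : ∀ u y l z, g u y = some (l, z) → S (u + 1) y = S u y + (2 : ℝ)⁻¹ ^ l := by
    intro u y l z h
    simp only [S]
    rw [Finset.sum_range_succ, h]
    rfl
  -- The codeword `q` is `c` written with `l + 1` bits. If `c ≥ 2^(l+1)`, no `q` qualifies and the
  -- request is dropped, so prefix-freeness needs no bound on the total weight.
  let D : ℕ → List Bool → List ℕ → Option (List ℕ) := fun u q y =>
    (g u y).bind fun a =>
      if q.length = a.1 + 1 ∧ strNum q + 1 = 2 ^ (a.1 + 1) + c u y a.1 then some a.2 else none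
  have hD : ∀ {u q y z}, D u q y = some z ↔ ∃ l, g u y = some (l, z) ∧ q.length = l + 1 ∧
      strNum q + 1 = 2 ^ (l + 1) + c u y l := by
    intro u q y z
    simp only [D, Option.bind_eq_some_iff, Option.ite_none_right_eq_some, Option.some.injEq]
    constructor
    · rintro ⟨⟨l, z'⟩, h, h', rfl⟩
      exact ⟨l, h, h'⟩
    · rintro ⟨l, h, h'⟩
      exact ⟨(l, z), h, h', rfl⟩
  -- The dyadic interval of `q ++ r` lies in that of `q`, whereas different requests own
  -- non-overlapping intervals; hence `u = u'`.
  have hpre : ∀ {u u' q r y z z'}, D u q y = some z → D u' (q ++ r) y = some z' →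
      z = z' ∧ r = [] := by
    intro u u' q r y z z' h h'
    obtain ⟨l, hgu, hlen, hnum⟩ := hD.1 h
    obtain ⟨l', hgu', hlen', hnum'⟩ := hD.1 h'
    have b := Real.natCeil_scale_bounds (l := l) (hSA u y)
    have b' := Real.natCeil_scale_bounds (l := l') (hSA u' y)
    have s := hSsucc u y l z hgu
    have s' := hSsucc u' y l' z' hgu'
    have hr := strNum_append_bounds q r
    rw [hnum'] at hr
    have e : l' + 1 = l + 1 + r.length := by rw [← hlen', ← hlen, List.length_append]
    have e2 : strNum q + 2 = 2 ^ (l + 1) + c u y l + 1 := by omega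
    rw [e2, hnum] at hr
    have hpow : 2 ^ (l' + 1) = 2 ^ (l + 1) * 2 ^ r.length := by rw [e, pow_add]
    rw [hpow] at hr
    have lo : c u y l * 2 ^ r.length ≤ c u' y l' := by linarith [hr.1]
    have hi : c u' y l' < (c u y l + 1) * 2 ^ r.length := by linarith [hr.2]
    have hpowR : (2 : ℝ) ^ (l' + 1) = 2 ^ (l + 1) * 2 ^ r.length := by rw [e, pow_add]
    have hscale : ∀ x : ℝ, x / 2 ^ (l + 1) = x * 2 ^ r.length / 2 ^ (l' + 1) := fun x => by
      rw [hpowR, mul_div_mul_right _ _ (by positivity)]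
    have lo' : (c u y l : ℝ) / 2 ^ (l + 1) ≤ c u' y l' / 2 ^ (l' + 1) := by
      rw [hscale]
      gcongr
      exact_mod_cast lo
    have hi' : (c u' y l' : ℝ) / 2 ^ (l' + 1) < (c u y l + 1) / 2 ^ (l + 1) := by
      rw [hscale]
      gcongr
      exact_mod_cast hi
    have hlt : (c u' y l' : ℝ) / 2 ^ (l' + 1) < (c u' y l' + 1) / 2 ^ (l' + 1) := by
      gcongr
      linarith
    rcases lt_trichotomy u u' with hu | rfl | hu
    · have := hSmono y (show u + 1 ≤ u' from hu)
      simp only at this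
      linarith [b.2, b'.1]
    · rw [hgu] at hgu'
      obtain ⟨rfl, rfl⟩ := Prod.mk.inj (Option.some_injective _ hgu')
      exact ⟨rfl, List.length_eq_zero_iff.1 (by omega)⟩
    · have := hSmono y (show u' + 1 ≤ u from hu)
      simp only at this
      linarith [b'.2, b.1]
  let V : List Bool → List ℕ →. List ℕ := fun q y => Nat.rfindOpt fun u => D u q y
  have hA : Computable₂ A := by
    refine Computable.sum_range (f := fun (a : ℕ × List ℕ) i =>
      (g i a.2).elim 0 fun b => 2 ^ (a.1 + d - b.1)) Computable.fst ?_
    refine (Computable.option_casesOn (f := fun _ => 0)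
      (g := fun (a : (ℕ × List ℕ) × ℕ) (b : ℕ × List ℕ) => 2 ^ (a.1.1 + d - b.1))
      (hg.comp Computable.snd (Computable.snd.comp Computable.fst)) (Computable.const 0)
      (Computable.two_pow (Computable.nat_sub (Computable.nat_add (Computable.fst.comp
        (Computable.fst.comp Computable.fst)) (Computable.const d))
          (Computable.fst.comp Computable.snd)))).of_eq fun a => ?_
    dsimp only
    cases g a.2 a.1.2 <;> rfl
  have hV : RecursiveIn₂ ∅ V := by
    refine Partrec.recursiveIn (Partrec.rfindOpt ?_)
    refine Computable.option_bind (hg.comp Computable.snd (Computable.snd.comp Computable.fst)) ?_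
    have hu : Computable fun a : ((List Bool × List ℕ) × ℕ) × ℕ × List ℕ => a.1.2 :=
      Computable.snd.comp Computable.fst
    have hq : Computable fun a : ((List Bool × List ℕ) × ℕ) × ℕ × List ℕ => a.1.1.1 :=
      Computable.fst.comp (Computable.fst.comp Computable.fst)
    have hy : Computable fun a : ((List Bool × List ℕ) × ℕ) × ℕ × List ℕ => a.1.1.2 :=
      Computable.snd.comp (Computable.fst.comp Computable.fst)
    have hl1 : Computable fun a : ((List Bool × List ℕ) × ℕ) × ℕ × List ℕ => a.2.1 + 1 :=
      Computable.succ.comp (Computable.fst.comp Computable.snd)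
    have hp : Computable fun a : ((List Bool × List ℕ) × ℕ) × ℕ × List ℕ => 2 ^ (a.1.2 + d) :=
      Computable.two_pow (Computable.nat_add hu (Computable.const d))
    refine Computable.ite (ComputablePred.and' (Computable.computablePred_eq
      (Computable.list_length.comp hq) hl1) (Computable.computablePred_eq
      (Computable.succ.comp (Primrec.strNum.to_comp.comp hq))
      (Computable.nat_add (Computable.two_pow hl1) (Computable.nat_div (Computable.nat_sub
        (Computable.nat_add (Computable.nat_mul (hA.comp hu hy) (Computable.two_pow hl1)) hp)
        (Computable.const 1)) hp))))
      (Computable.option_some.comp (Computable.snd.comp Computable.snd)) (Computable.const none)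
  have hV' : IsPrefixFree V := by
    rintro y p _ hd1 hd2 ⟨r, rfl⟩
    obtain ⟨u, z, hz⟩ := Nat.rfindOpt_dom.1 hd1
    obtain ⟨u', z', hz'⟩ := Nat.rfindOpt_dom.1 hd2
    simp [(hpre hz hz').2]
  obtain ⟨w, hw⟩ := hΦ.2.2 V hV hV'
  refine ⟨w.length + 1, fun y u l z hgu hsum => ?_⟩
  have b := Real.natCeil_scale_bounds (l := l) (hSA u y)
  have hc : c u y l < 2 ^ (l + 1) := by
    have h1 : ((c u y l : ℝ) + 1) / 2 ^ (l + 1) ≤ 1 :=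
      b.2.trans ((hSsucc u y l z hgu).symm.le.trans hsum)
    rw [div_le_one (by positivity)] at h1
    exact_mod_cast (Nat.lt_iff_add_one_le.2 (by exact_mod_cast h1))
  set q := numStr (2 ^ (l + 1) + c u y l - 1) with hq
  have hpos : 0 < 2 ^ (l + 1) := by positivity
  have hqnum : strNum q + 1 = 2 ^ (l + 1) + c u y l := by
    rw [hq, strNum_numStr]
    omega
  have hqlen : q.length = l + 1 := by
    rw [← natLen_strNum]
    refine Nat.log_eq_of_pow_le_of_lt_pow (by omega) ?_
    rw [hqnum, pow_succ 2 (l + 1)]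
    omega
  have hDu : D u q y = some z := hD.2 ⟨l, hgu, hqlen, hqnum⟩
  have hz : z ∈ V q y := by
    -- The search returns the first hit; `hpre` with `r = []` shows that every hit gives the same
    -- output.
    obtain ⟨z', hz'⟩ := Part.dom_iff_mem.1 ((Nat.rfindOpt_dom (f := fun u => D u q y)).2 ⟨u, z, hDu⟩)
    obtain ⟨u', hu'⟩ := Nat.rfindOpt_spec hz'
    obtain rfl := (hpre (r := []) (z' := z) hu' (by rwa [List.append_nil])).1
    exact hz'
  rw [← hw] at hz
  refine (complexity_le hz).trans ?_
  rw [List.length_append, hqlen]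
  omega

end Universal

/-! ### Approximations of `Ω^n` and late programs -/

namespace Interpreter

variable (Φ : Interpreter)

theorem step_unique {s t : ℕ} {p : List Bool} {y z z' : List ℕ} (h : Φ.step s p y = some z)
    (h' : Φ.step t p y = some z') : z = z' := by
  rcases le_total s t with hst | hst
  · exact Option.some_injective _ ((Φ.step_mono hst h).symm.trans h')
  · exact Option.some_injective _ (h.symm.trans (Φ.step_mono hst h'))

theorem programsWithin_mono (n : ℕ) : Monotone (Φ.programsWithin n) :=
  fun _ _ hst _ ⟨x, hx, h⟩ => ⟨x, hx, Φ.step_mono hst h⟩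

theorem omegaWithin_eq_sum (n t : ℕ) : Φ.omegaWithin n t =
    ∑ p ∈ (Φ.finite_programsWithin n t).toFinset, (2 : ℝ)⁻¹ ^ p.length := by
  unfold omegaWithin
  rw [← Finset.tsum_subtype' _ (fun p : List Bool => (2 : ℝ)⁻¹ ^ p.length),
    Set.Finite.coe_toFinset]

variable {Φ} in
theorem bddAbove_omegaWithin (hΦ : IsPrefixFree Φ.eval) (n : ℕ) :
    BddAbove (Set.range (Φ.omegaWithin n)) :=
  ⟨1, by rintro _ ⟨r, rfl⟩; exact Φ.omegaWithin_le_one hΦ n r⟩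

variable {Φ} in
theorem omegaWithin_le_omega (hΦ : IsPrefixFree Φ.eval) (n t : ℕ) :
    Φ.omegaWithin n t ≤ Φ.omega n :=
  le_ciSup (bddAbove_omegaWithin hΦ n) t

variable {Φ} in
theorem omega_le_one (hΦ : IsPrefixFree Φ.eval) (n : ℕ) : Φ.omega n ≤ 1 :=
  ciSup_le fun t => Φ.omegaWithin_le_one hΦ n t

theorem omegaWithin_nonneg (n t : ℕ) : 0 ≤ Φ.omegaWithin n t :=
  tsum_nonneg fun _ => by positivity

variable {Φ} in
theorem omega_nonneg (hΦ : IsPrefixFree Φ.eval) (n : ℕ) : 0 ≤ Φ.omega n :=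
  (Φ.omegaWithin_nonneg n 0).trans (omegaWithin_le_omega hΦ n 0)

variable {Φ} in
-- At a later time by which all programs in `F` have halted, their weight has been added to what was
-- present at time `s`.
theorem omegaWithin_add_sum_le (hΦ : IsPrefixFree Φ.eval) {n s : ℕ} (F : Finset (List Bool))
    (hF : ∀ p ∈ F, ∃ t, p ∈ Φ.programsWithin n t) (hs : ∀ p ∈ F, p ∉ Φ.programsWithin n s) :
    Φ.omegaWithin n s + ∑ p ∈ F, (2 : ℝ)⁻¹ ^ p.length ≤ Φ.omega n := by
  classical
  choose! τ hτ using hF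
  set T := max s (F.sup τ) with hT
  refine le_trans ?_ (omegaWithin_le_omega hΦ n T)
  rw [omegaWithin_eq_sum, omegaWithin_eq_sum, ← Finset.sum_union]
  · refine Finset.sum_le_sum_of_subset_of_nonneg ?_ (fun _ _ _ => by positivity)
    intro q hq
    rw [Finset.mem_union, Set.Finite.mem_toFinset] at hq
    rw [Set.Finite.mem_toFinset]
    rcases hq with hq | hq
    · exact Φ.programsWithin_mono n (le_max_left _ _) hq
    · exact Φ.programsWithin_mono n ((Finset.le_sup hq).trans (le_max_right _ _)) (hτ q hq)
  · rw [Finset.disjoint_left]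
    intro p hp hp'
    rw [Set.Finite.mem_toFinset] at hp
    exact hs p hp' hp

/-- This form has no quantifier over strings `x` and is visibly decidable. -/
theorem mem_programsWithin_iff {n t : ℕ} {p : List Bool} : p ∈ Φ.programsWithin n t ↔
    ∃ z ∈ Φ.step t p [n], z.length = 1 ∧ natLen z.headI = n := by
  constructor
  · rintro ⟨x, hx, h⟩
    exact ⟨_, h, rfl, by rw [List.headI_cons, natLen_strNum, hx]⟩
  · rintro ⟨z, hz, h1, h2⟩
    obtain ⟨v, rfl⟩ := List.length_eq_one_iff.1 h1
    exact ⟨numStr v, by rwa [length_numStr], by rw [strNum_numStr]; exact hz⟩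

theorem computablePred_programsWithin : ComputablePred fun a : ℕ × ℕ × List Bool =>
    a.2.2 ∈ Φ.programsWithin a.1 a.2.1 := by
  have h1 : Computable fun a : ℕ × ℕ × List Bool => Φ.step a.2.1 a.2.2 [a.1] :=
    Φ.computable_step.comp (Computable.pair (Computable.fst.comp Computable.snd)
      (Computable.pair (Computable.snd.comp Computable.snd)
        (Computable.singleton Computable.fst)))
  have h2 : Computable₂ fun (a : ℕ × ℕ × List Bool) (z : List ℕ) =>
      decide (z.length = 1 ∧ natLen z.headI = a.1) :=
    (ComputablePred.and' (Computable.computablePred_eq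
      (Computable.list_length.comp Computable.snd) (Computable.const 1))
      (Computable.computablePred_eq (Primrec.natLen.to_comp.comp
        (Primrec.list_headI.to_comp.comp Computable.snd))
        (Computable.fst.comp Computable.fst))).decide
  classical
  refine Computable.computablePred ((Computable.option_casesOn h1 (Computable.const false)
    h2).of_eq fun a => ?_)
  rw [mem_programsWithin_iff]
  cases Φ.step a.2.1 a.2.2 [a.1] <;> simp

open Classical in
/-- The numerator of `Ω^n_t` over the denominator `2^t`. -/
noncomputable def omegaNum (n t : ℕ) : ℕ :=
  ∑ i ∈ Finset.range (2 ^ (t + 1)), if numStr i ∈ Φ.programsWithin n t then 2 ^ (t - natLen i)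
    else 0

theorem omegaWithin_eq (n t : ℕ) : Φ.omegaWithin n t = Φ.omegaNum n t / 2 ^ t := by
  classical
  rw [omegaWithin_eq_sum, omegaNum, ← Finset.sum_filter, Nat.cast_sum, Finset.sum_div]
  refine Finset.sum_bij' (fun p _ => strNum p) (fun i _ => numStr i) ?_ ?_ ?_ ?_ ?_
  · intro p hp
    rw [Set.Finite.mem_toFinset] at hp
    rw [Finset.mem_filter, Finset.mem_range, numStr_strNum]
    refine ⟨?_, hp⟩
    obtain ⟨x, -, h⟩ := hp
    have h1 := strNum_lt_two_pow p
    have h2 : 2 ^ (p.length + 1) ≤ 2 ^ (t + 1) :=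
      Nat.pow_le_pow_right two_pos (Nat.succ_le_succ (Φ.length_le h))
    omega
  · intro i hi
    rw [Set.Finite.mem_toFinset]
    exact (Finset.mem_filter.1 hi).2
  · exact fun p _ => numStr_strNum p
  · exact fun i _ => strNum_numStr i
  · intro p hp
    rw [Set.Finite.mem_toFinset] at hp
    obtain ⟨x, -, h⟩ := hp
    rw [natLen_strNum, Nat.cast_pow, Nat.cast_ofNat, inv_pow,
      pow_sub₀ (2 : ℝ) two_ne_zero (Φ.length_le h)]
    field_simp

theorem computable_omegaNum : Computable₂ Φ.omegaNum := by
  classical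
  have hg : Computable fun b : (ℕ × ℕ) × ℕ => (b.1.1, b.1.2, numStr b.2) :=
    Computable.pair (Computable.fst.comp Computable.fst) (Computable.pair
      (Computable.snd.comp Computable.fst) (Primrec.numStr.to_comp.comp Computable.snd))
  have hP : ComputablePred fun b : (ℕ × ℕ) × ℕ => numStr b.2 ∈ Φ.programsWithin b.1.1 b.1.2 :=
    Φ.computablePred_programsWithin.comp' hg
  have hpow : Computable fun b : (ℕ × ℕ) × ℕ => 2 ^ (b.1.2 - natLen b.2) :=
    Computable.two_pow (Computable.nat_sub (Computable.snd.comp Computable.fst)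
      (Primrec.natLen.to_comp.comp Computable.snd))
  have hN : Computable fun a : ℕ × ℕ => 2 ^ (a.2 + 1) :=
    Computable.two_pow (Computable.succ.comp Computable.snd)
  have h := Computable.sum_range hN (Computable.ite hP hpow (Computable.const 0)).to₂
  exact h.of_eq fun a => by simp only [omegaNum]

/-- The program with number `i` halts at time `s + 1` exactly, with a string of length `n`, and
`(m - 2) / 2^k` is at most `Ω^n_s`. -/
def LateHalt (n k m s i : ℕ) : Prop :=
  numStr i ∈ Φ.programsWithin n (s + 1) ∧ numStr i ∉ Φ.programsWithin n s ∧
    (m - 2) * 2 ^ s ≤ Φ.omegaNum n s * 2 ^ k ∧ k ≤ natLen i + 2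

open Classical in
/-- Every late program of length `l` asks for a description of length `l + 2 - k` of its output. -/
noncomputable def lateRequest (u : ℕ) (y : List ℕ) : Option (ℕ × List ℕ) :=
  if Φ.LateHalt y.headI y.tail.headI y.tail.tail.headI u.unpair.1 u.unpair.2 then
    some (natLen u.unpair.2 + 2 - y.tail.headI,
      (Φ.step (u.unpair.1 + 1) (numStr u.unpair.2) [y.headI]).getD [])
  else none

theorem computable_lateRequest : Computable₂ Φ.lateRequest := by
  classical
  have hn : Computable fun a : ℕ × List ℕ => a.2.headI :=
    Primrec.list_headI.to_comp.comp Computable.snd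
  have hk : Computable fun a : ℕ × List ℕ => a.2.tail.headI :=
    Primrec.list_headI.to_comp.comp (Primrec.list_tail.to_comp.comp Computable.snd)
  have hm : Computable fun a : ℕ × List ℕ => a.2.tail.tail.headI :=
    Primrec.list_headI.to_comp.comp (Primrec.list_tail.to_comp.comp
      (Primrec.list_tail.to_comp.comp Computable.snd))
  have hs : Computable fun a : ℕ × List ℕ => a.1.unpair.1 :=
    Computable.fst.comp (Computable.unpair.comp Computable.fst)
  have hi : Computable fun a : ℕ × List ℕ => a.1.unpair.2 :=
    Computable.snd.comp (Computable.unpair.comp Computable.fst)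
  have hp : Computable fun a : ℕ × List ℕ => numStr a.1.unpair.2 := Primrec.numStr.to_comp.comp hi
  have hl : Computable fun a : ℕ × List ℕ => natLen a.1.unpair.2 + 2 :=
    Computable.nat_add (Primrec.natLen.to_comp.comp hi) (Computable.const 2)
  have hP : ∀ t : ℕ × List ℕ → ℕ, Computable t → ComputablePred fun a : ℕ × List ℕ =>
      numStr a.1.unpair.2 ∈ Φ.programsWithin a.2.headI (t a) := fun t ht =>
    Φ.computablePred_programsWithin.comp' (Computable.pair hn (Computable.pair ht hp))
  refine Computable.ite ?_ (Computable.option_some.comp (Computable.pair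
    (Computable.nat_sub hl hk) (Computable.option_getD (Φ.computable_step.comp
      (Computable.pair (Computable.succ.comp hs) (Computable.pair hp (Computable.singleton hn))))
      (Computable.const [])))) (Computable.const none)
  refine ComputablePred.and' (hP _ (Computable.succ.comp hs))
    (ComputablePred.and' (hP _ hs).not
      (ComputablePred.and' (Computable.computablePred_le (Computable.nat_mul
        (Computable.nat_sub hm (Computable.const 2)) (Computable.two_pow hs))
        (Computable.nat_mul (Φ.computable_omegaNum.comp hn hs) (Computable.two_pow hk)))
        (Computable.computablePred_le hk hl)))

theorem mul_two_pow_le_omegaNum_iff {n k m s : ℕ} :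
    m * 2 ^ s ≤ Φ.omegaNum n s * 2 ^ k ↔ (m : ℝ) ≤ 2 ^ k * Φ.omegaWithin n s := by
  rw [omegaWithin_eq, ← mul_div_assoc, le_div_iff₀ (by positivity), mul_comm (2 ^ k : ℝ)]
  exact_mod_cast Iff.rfl

variable {Φ} in
theorem LateHalt.unique {n k m s s' i : ℕ} (h : Φ.LateHalt n k m s i)
    (h' : Φ.LateHalt n k m s' i) : s = s' := by
  rcases lt_trichotomy s s' with hs | hs | hs
  · exact absurd (Φ.programsWithin_mono n (Nat.succ_le_of_lt hs) h.1) h'.2.1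
  · exact hs
  · exact absurd (Φ.programsWithin_mono n (Nat.succ_le_of_lt hs) h'.1) h.2.1

variable {Φ} in
-- Let `s` be the first time with `m - 2 ≤ 2^k Ω^n_s`. Late programs halt after `s`, each at a
-- unique time, so their weight is at most `Ω^n - Ω^n_s ≤ 3 · 2^{-k}`. The requests multiply weights
-- by `2^k/4`, which gives at most `3/4`.
theorem sum_requestWeight_lateRequest_le (hΦ : IsPrefixFree Φ.eval) {n k m : ℕ}
    (hm : 2 ^ k * Φ.omega n ≤ m + 1) (N : ℕ) :
    ∑ u ∈ Finset.range N, requestWeight (Φ.lateRequest u [n, k, m]) ≤ 1 := by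
  classical
  let E : Finset ℕ := (Finset.range N).filter fun u => Φ.LateHalt n k m u.unpair.1 u.unpair.2
  have hEmem : ∀ {u}, u ∈ E → Φ.LateHalt n k m u.unpair.1 u.unpair.2 :=
    fun hu => (Finset.mem_filter.1 hu).2
  have hweight : ∀ u, requestWeight (Φ.lateRequest u [n, k, m]) =
      if Φ.LateHalt n k m u.unpair.1 u.unpair.2 then
        2 ^ k / 4 * (2 : ℝ)⁻¹ ^ natLen u.unpair.2 else 0 := by
    intro u
    by_cases h : Φ.LateHalt n k m u.unpair.1 u.unpair.2
    · have e : requestWeight (Φ.lateRequest u [n, k, m]) =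
          (2 : ℝ)⁻¹ ^ (natLen u.unpair.2 + 2 - k) := by
        simp [lateRequest, requestWeight, h]
      rw [e, if_pos h, inv_pow, inv_pow, pow_sub₀ (2 : ℝ) two_ne_zero h.2.2.2, pow_add]
      field_simp
      norm_num
    · simp [lateRequest, requestWeight, h]
  rw [Finset.sum_congr rfl fun u _ => hweight u, ← Finset.sum_filter, ← Finset.mul_sum]
  change 2 ^ k / 4 * ∑ u ∈ E, (2 : ℝ)⁻¹ ^ natLen u.unpair.2 ≤ 1
  rcases E.eq_empty_or_nonempty with hE | ⟨u₀, hu₀⟩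
  · simp [hE]
  have hex : ∃ s, (m - 2) * 2 ^ s ≤ Φ.omegaNum n s * 2 ^ k := ⟨_, (hEmem hu₀).2.2.1⟩
  have hs₀ := Φ.mul_two_pow_le_omegaNum_iff.1 (Nat.find_spec hex)
  have hmin : ∀ u ∈ E, Nat.find hex ≤ u.unpair.1 := fun u hu => Nat.find_min' hex (hEmem hu).2.2.1
  have hinj : Set.InjOn (fun u : ℕ => numStr u.unpair.2) E := by
    intro u hu u' hu' h
    have h2 : u.unpair.2 = u'.unpair.2 := by
      have := congrArg strNum h
      rwa [strNum_numStr, strNum_numStr] at this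
    have h1 := (hEmem hu).unique (h2 ▸ hEmem hu')
    rw [← Nat.pair_unpair u, h1, h2, Nat.pair_unpair]
  have hsum := omegaWithin_add_sum_le hΦ (n := n) (s := Nat.find hex)
    (E.image fun u => numStr u.unpair.2)
    (by
      simp only [Finset.mem_image]
      rintro _ ⟨u, hu, rfl⟩
      exact ⟨_, (hEmem hu).1⟩)
    (by
      simp only [Finset.mem_image]
      rintro _ ⟨u, hu, rfl⟩ h
      exact (hEmem hu).2.1 (Φ.programsWithin_mono n (hmin u hu) h))
  rw [Finset.sum_image hinj] at hsum
  simp only [length_numStr] at hsum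
  -- Truncated subtraction can only raise the threshold, which is harmless here.
  have hm2 : (m : ℝ) - 2 ≤ ((m - 2 : ℕ) : ℝ) := by
    rw [sub_le_iff_le_add]
    exact_mod_cast Nat.le_add_of_sub_le le_rfl
  have hk : (0 : ℝ) < 2 ^ k := by positivity
  have := mul_le_mul_of_nonneg_left hsum hk.le
  rw [mul_add] at this
  rw [div_mul_eq_mul_div, div_le_one (by norm_num)]
  linarith

variable {Φ} in
/-- If `Ω^n` is known up to `2^{-k}`, then a program of length `l` that halts after the time when
the remaining part of `Ω^n` has dropped to `2 * 2^{-k}` can be replaced by one of length `l - k`. -/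
theorem exists_complexity_add_le_length (hΦ : IsUniversal ∅ Φ.eval) :
    ∃ C, ∀ (x : List Bool) (k m t t' : ℕ) (p : List Bool),
      m ≤ 2 ^ k * Φ.omega x.length → 2 ^ k * Φ.omega x.length ≤ m + 1 →
      2 ^ k * (Φ.omega x.length - Φ.omegaWithin x.length t) ≤ 2 →
      Φ.step t' p [x.length] = some [strNum x] → Φ.step t p [x.length] ≠ some [strNum x] →
      k + complexity Φ.eval [strNum x] [x.length, k, m] ≤ p.length + C := by
  have hlen : ∀ u y l z, Φ.lateRequest u y = some (l, z) → l ≤ u + 3 := by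
    intro u y l z h
    simp only [lateRequest, Option.ite_none_right_eq_some] at h
    obtain ⟨⟨⟨x, -, hx⟩, -⟩, h⟩ := h
    have h1 := (Prod.mk.inj (Option.some_injective _ h)).1
    have h2 := Φ.length_le hx
    rw [length_numStr] at h2
    have h3 := Nat.unpair_left_le u
    omega
  -- A program halting at time `s + 1` has length at most `s + 1 ≤ u + 1`; the request adds 2 bits,
  -- whence 3.
  obtain ⟨C, hC⟩ := hΦ.exists_complexity_le_request 3 Φ.computable_lateRequest hlen
  refine ⟨C + 2, fun x k m t t' p hm hm' ht hx hx' => ?_⟩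
  set n := x.length with hn
  have hk0 : (0 : ℝ) < 2 ^ k := by positivity
  have hnot : p ∉ Φ.programsWithin n t := by
    rintro ⟨x', -, h⟩
    rw [Φ.step_unique h hx] at h
    exact hx' h
  have hmem : p ∈ Φ.programsWithin n t' := ⟨x, rfl, hx⟩
  obtain ⟨s, hs, hs1, hs2⟩ : ∃ s, t ≤ s ∧ p ∈ Φ.programsWithin n (s + 1) ∧
      p ∉ Φ.programsWithin n s := by
    classical
    have hex : ∃ r, p ∈ Φ.programsWithin n (t + r) :=
      ⟨t', Φ.programsWithin_mono n (Nat.le_add_left _ _) hmem⟩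
    have hpos : Nat.find hex ≠ 0 := fun h => hnot (by simpa [h] using Nat.find_spec hex)
    obtain ⟨r, hr⟩ := Nat.exists_eq_succ_of_ne_zero hpos
    refine ⟨t + r, Nat.le_add_right _ _, ?_, Nat.find_min hex (by omega)⟩
    have := Nat.find_spec hex
    rwa [hr] at this
  -- The weight of `p` is part of the missing `2 · 2^{-k}`. This keeps `p.length + 2 - k` from being
  -- truncated.
  have hkl : k ≤ p.length + 1 := by
    have := omegaWithin_add_sum_le hΦ.2.1 (n := n) (s := t) {p} (by simpa using ⟨t', hmem⟩)
      (by simpa using hnot)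
    rw [Finset.sum_singleton] at this
    have h1 : (2 : ℝ) ^ k * 2⁻¹ ^ p.length ≤ 2 :=
      (mul_le_mul_of_nonneg_left (by linarith) hk0.le).trans ht
    rw [inv_pow, mul_inv_le_iff₀ (by positivity), ← pow_succ'] at h1
    exact (pow_le_pow_iff_right₀ one_lt_two).1 h1
  have hthr : (m - 2) * 2 ^ s ≤ Φ.omegaNum n s * 2 ^ k := by
    rw [mul_two_pow_le_omegaNum_iff]
    have h1 : 2 ^ k * Φ.omegaWithin n t ≤ 2 ^ k * Φ.omegaWithin n s :=
      mul_le_mul_of_nonneg_left (Φ.omegaWithin_mono n hs) hk0.le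
    rcases le_total m 2 with h | h
    · rw [Nat.sub_eq_zero_of_le h, Nat.cast_zero]
      exact mul_nonneg hk0.le (Φ.omegaWithin_nonneg n s)
    · rw [Nat.cast_sub h]
      push_cast
      linarith
  have hstep : Φ.step (s + 1) p [n] = some [strNum x] := by
    obtain ⟨x', -, h⟩ := hs1
    rw [h, Φ.step_unique h hx]
  have hlate : Φ.LateHalt n k m s (strNum p) := by
    refine ⟨?_, ?_, hthr, ?_⟩
    · rwa [numStr_strNum]
    · rwa [numStr_strNum]
    · rw [natLen_strNum]
      omega
  have hreq : Φ.lateRequest (Nat.pair s (strNum p)) [n, k, m] =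
      some (p.length + 2 - k, [strNum x]) := by
    simp [lateRequest, hlate, natLen_strNum, numStr_strNum, hstep]
  have := hC _ _ _ _ hreq (sum_requestWeight_lateRequest_le hΦ.2.1 hm' _)
  omega

end Interpreter

/-! ### Self-delimiting headers -/

section Headers

/-- The self-delimiting code `0^l 1 b` of the number of the string `b` of length `l`. -/
def natHeader (k : ℕ) : List Bool := List.replicate (natLen k) false ++ true :: numStr k

theorem length_natHeader (k : ℕ) : (natHeader k).length = 2 * natLen k + 1 := by
  simp only [natHeader, List.length_append, List.length_replicate, List.length_cons, length_numStr]
  omega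

/-- Splits a string into a number in its self-delimiting code and the rest. -/
def parseNat (p : List Bool) : Option (ℕ × List Bool) :=
  if 2 * p.idxOf true + 1 ≤ p.length then
    some (strNum ((p.drop (p.idxOf true + 1)).take (p.idxOf true)),
      p.drop (2 * p.idxOf true + 1))
  else none

theorem computable_parseNat : Computable parseNat := by
  have hi : Computable fun p : List Bool => p.idxOf true :=
    (Primrec.list_idxOf.comp (Primrec.const true) Primrec.id).to_comp
  have hj : Computable fun p : List Bool => 2 * p.idxOf true + 1 :=
    Computable.succ.comp (Computable.nat_mul (Computable.const 2) hi)
  exact Computable.ite (Computable.computablePred_le hj Computable.list_length)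
    (Computable.option_some.comp (Computable.pair (Primrec.strNum.to_comp.comp
      (Primrec.list_take.to_comp.comp hi (Primrec.list_drop.to_comp.comp
        (Computable.succ.comp hi) Computable.id)))
      (Primrec.list_drop.to_comp.comp hj Computable.id))) (Computable.const none)

theorem parseNat_append {p q : List Bool} {a : ℕ} (r : List Bool)
    (h : parseNat p = some (a, q)) : parseNat (p ++ r) = some (a, q ++ r) := by
  simp only [parseNat, Option.ite_none_right_eq_some, Option.some.injEq, Prod.mk.injEq] at h ⊢
  obtain ⟨hl, rfl, rfl⟩ := h
  have hmem : true ∈ p := List.idxOf_lt_length_iff.1 (by omega)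
  rw [List.idxOf_append_of_mem hmem, List.length_append]
  refine ⟨by omega, ?_, List.drop_append_of_le_length hl⟩
  rw [List.drop_append_of_le_length (by omega), List.take_append_of_le_length]
  rw [List.length_drop]
  omega

theorem idxOf_replicate_false (N : ℕ) (q : List Bool) :
    (List.replicate N false ++ true :: q).idxOf true = N := by
  rw [List.idxOf_append_of_notMem (by simp [List.mem_replicate])]
  simp

theorem parseNat_natHeader (k : ℕ) (q : List Bool) : parseNat (natHeader k ++ q) = some (k, q) := by
  have h : parseNat (natHeader k) = some (k, []) := by
    have hi : (natHeader k).idxOf true = natLen k := idxOf_replicate_false _ _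
    have hd : (natHeader k).drop (natLen k + 1) = numStr k := by
      rw [natHeader, List.append_cons, List.drop_left' (by simp)]
    rw [parseNat, hi, if_pos (length_natHeader k).ge, hd,
      List.take_of_length_le (length_numStr k).le, strNum_numStr,
      List.drop_of_length_le (length_natHeader k).le]
  simpa using parseNat_append q h

/-- Splits a string into the self-delimiting code of a number `k`, a block of `k` bits and the
rest. -/
def parseBlock (p : List Bool) : Option (ℕ × List Bool) :=
  (parseNat p).bind fun a =>
    if a.1 ≤ a.2.length then some (strNum (a.2.take a.1), a.2.drop a.1) else none

theorem computable_parseBlock : Computable parseBlock := by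
  have hk : Computable fun b : List Bool × ℕ × List Bool => b.2.1 :=
    Computable.fst.comp Computable.snd
  have hq : Computable fun b : List Bool × ℕ × List Bool => b.2.2 :=
    Computable.snd.comp Computable.snd
  exact Computable.option_bind computable_parseNat
    (Computable.ite (Computable.computablePred_le hk (Computable.list_length.comp hq))
      (Computable.option_some.comp (Computable.pair (Primrec.strNum.to_comp.comp
        (Primrec.list_take.to_comp.comp hk hq)) (Primrec.list_drop.to_comp.comp hk hq)))
      (Computable.const none)).to₂

theorem parseBlock_append {p q : List Bool} {a : ℕ} (r : List Bool)
    (h : parseBlock p = some (a, q)) : parseBlock (p ++ r) = some (a, q ++ r) := by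
  simp only [parseBlock, Option.bind_eq_some_iff, Option.ite_none_right_eq_some,
    Option.some.injEq, Prod.mk.injEq] at h ⊢
  obtain ⟨⟨k, q'⟩, hp, hl, rfl, rfl⟩ := h
  refine ⟨_, parseNat_append r hp, ?_, ?_, List.drop_append_of_le_length hl⟩
  · rw [List.length_append]
    exact hl.trans (Nat.le_add_right _ _)
  · rw [List.take_append_of_le_length hl]

theorem parseBlock_natHeader (b q : List Bool) :
    parseBlock (natHeader b.length ++ b ++ q) = some (strNum b, q) := by
  rw [parseBlock, List.append_assoc, parseNat_natHeader]
  simp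

end Headers

/-! ### Depth, initial bits of `Ω^n` and the halting sequence -/

namespace Interpreter

variable {Φ : Interpreter}

theorem complexityWithin_le_iff {t a : ℕ} {x y : List ℕ} :
    Φ.complexityWithin t x y ≤ a ↔ ∃ p, Φ.step t p y = some x ∧ p.length ≤ a := by
  constructor
  · intro h
    by_contra! hcon
    have h1 : ((a + 1 : ℕ) : ℕ∞) ≤ Φ.complexityWithin t x y :=
      le_iInf₂ fun p hp => Nat.cast_le.2 (hcon p hp)
    have h2 := Nat.cast_le.1 (h1.trans h)
    omega
  · rintro ⟨p, hp, hl⟩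
    exact (iInf₂_le p hp).trans (Nat.cast_le.2 hl)

theorem omega_sub_omegaWithin_omegaTime_le (n k : ℕ) :
    Φ.omega n - Φ.omegaWithin n (Φ.omegaTime n k) ≤ (2 : ℝ)⁻¹ ^ k :=
  Nat.sInf_mem (Φ.exists_omegaTime n k)

theorem exists_program_depth (hΦ : IsUniversal ∅ Φ.eval) (c : ℕ) (x : List Bool) :
    ∃ p, Φ.step (Φ.omegaTime x.length (Φ.depth c x)) p [x.length] = some [strNum x] ∧
      p.length ≤ Φ.K x + c := by
  have h : Φ.complexityWithin (Φ.omegaTime x.length (Φ.depth c x)) [strNum x] [x.length] ≤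
      (Φ.K x : ℕ∞) + (c : ℕ∞) := Nat.sInf_mem (Φ.exists_depth hΦ c x)
  rw [← Nat.cast_add] at h
  exact complexityWithin_le_iff.1 h

theorem step_ne_of_lt_depth {c k : ℕ} {x p : List Bool} (hk : k < Φ.depth c x)
    (hp : p.length ≤ Φ.K x + c) :
    Φ.step (Φ.omegaTime x.length k) p [x.length] ≠ some [strNum x] := fun h => by
  refine Nat.notMem_of_lt_sInf hk (show Φ.complexityWithin _ _ _ ≤ (Φ.K x : ℕ∞) + (c : ℕ∞) from ?_)
  rw [← Nat.cast_add]
  exact complexityWithin_le_iff.2 ⟨p, h, hp⟩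

/-- The time belongs to `k` but the scale to `k + 1`: the lemma is applied one step below the depth,
which is where the bound 2 comes from. -/
theorem two_pow_mul_omega_sub_le {n k t : ℕ} (ht : Φ.omegaTime n k ≤ t) :
    2 ^ (k + 1) * (Φ.omega n - Φ.omegaWithin n t) ≤ 2 := by
  have h1 := omega_sub_omegaWithin_omegaTime_le (Φ := Φ) n k
  have h2 := Φ.omegaWithin_mono n ht
  have h3 : (2 : ℝ) ^ (k + 1) * 2⁻¹ ^ k = 2 := by
    rw [pow_succ, inv_pow]
    field_simp
  exact (mul_le_mul_of_nonneg_left (by linarith) (by positivity)).trans h3.le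

/-- Knowing `Ω^n` up to `2^{-k}`, where `k` is the depth of `x`, saves `k` bits in the description
of `x`. -/
theorem exists_complexity_add_depth_le (hΦ : IsUniversal ∅ Φ.eval) (c : ℕ) :
    ∃ C, ∀ (x : List Bool) (m : ℕ), m ≤ 2 ^ Φ.depth c x * Φ.omega x.length →
      2 ^ Φ.depth c x * Φ.omega x.length ≤ m + 1 →
      Φ.depth c x + complexity Φ.eval [strNum x] [x.length, Φ.depth c x, m] ≤ Φ.K x + C := by
  obtain ⟨C, hC⟩ := exists_complexity_add_le_length hΦ
  obtain ⟨C', hC'⟩ := hΦ.exists_complexity_le_comp (f := fun y => Part.some [y.headI])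
    (Computable.singleton Primrec.list_headI.to_comp)
  refine ⟨C + c + C', fun x m hm hm' => ?_⟩
  rcases hk : Φ.depth c x with _ | k
  -- At depth 0 there is nothing to save, and the additional conditions are discarded.
  · have : complexity Φ.eval [strNum x] [x.length, 0, m] ≤ Φ.K x + C' :=
      hC' [x.length, 0, m] [x.length] [strNum x] (Part.mem_some _)
    omega
  · obtain ⟨p, hp, hl⟩ := exists_program_depth hΦ c x
    rw [hk] at hm hm'
    have := hC x (k + 1) m _ _ p hm hm' (two_pow_mul_omega_sub_le le_rfl) hp
      (step_ne_of_lt_depth (by omega) hl)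
    omega

/-- For prefix-free `Φ` the reduction modulo `2^k` matters only when `Ω^n = 1`, where `Real.digits`
yields zeros. -/
theorem strNum_omegaBits (n k : ℕ) :
    strNum (Φ.omegaBits n k) + 1 = 2 ^ k + ⌊2 ^ k * Φ.omega n⌋₊ % 2 ^ k := by
  refine strNum_map_range (F := fun j => 2 ^ j + ⌊2 ^ j * Φ.omega n⌋₊ % 2 ^ j)
    (by simp [Nat.mod_one]) fun j _ => ?_
  have hdig : (Real.digits (Φ.omega n) 2 j = 1) ↔ ⌊2 ^ (j + 1) * Φ.omega n⌋₊ % 2 = 1 := by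
    rw [mul_comm, Fin.ext_iff]
    rfl
  have hdiv : ⌊2 ^ j * Φ.omega n⌋₊ = ⌊2 ^ (j + 1) * Φ.omega n⌋₊ / 2 := by
    rw [← Nat.floor_div_ofNat]
    congr 1
    rw [pow_succ]
    ring
  simp only [hdig, hdiv]
  generalize ⌊2 ^ (j + 1) * Φ.omega n⌋₊ = N
  have hb : (decide (N % 2 = 1)).toNat = N % 2 := by
    rcases Nat.mod_two_eq_zero_or_one N with h | h <;> simp [h]
  rw [hb, pow_succ', Nat.mod_mul]
  ring

theorem length_omegaBits (n k : ℕ) : (Φ.omegaBits n k).length = k := by simp [omegaBits]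

/-- A string, its complexity and its depth `k` compute the first `k` bits of `Ω^n`. -/
theorem exists_computes_omegaBits (hΦ : IsUniversal ∅ Φ.eval) (c : ℕ) :
    ∃ C, ∀ x : List Bool, Φ.Computes C x.length [strNum x, Φ.K x, Φ.depth c x]
      [strNum (Φ.omegaBits x.length (Φ.depth c x))] := by
  classical
  -- With `y = [x, K(x), k, n]`, the range of `i` lists exactly the programs of length at most `K(x)
  -- + c`.
  let S : List ℕ → ℕ → Prop := fun y t => ∃ i < 2 ^ (y.tail.headI + c + 1) - 1,
    Φ.step t (numStr i) [y.tail.tail.tail.headI] = some [y.headI]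
  -- `δ` is the hard-wired difference between the integer parts of `2^k Ω^n` and `2^k Ω^n_t`.
  let f : ℕ → List ℕ →. List ℕ := fun δ y =>
    (Nat.rfind fun t => Part.some (decide (S y t))).map fun t =>
      [2 ^ y.tail.tail.headI - 1 + (Φ.omegaNum y.tail.tail.tail.headI t * 2 ^ y.tail.tail.headI /
        2 ^ t + δ) % 2 ^ y.tail.tail.headI]
  have h0 : Computable (List.headI : List ℕ → ℕ) := Primrec.list_headI.to_comp
  have ht : Computable (List.tail : List ℕ → List ℕ) := Primrec.list_tail.to_comp
  have h1 : Computable fun y : List ℕ => y.tail.headI := h0.comp ht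
  have h2 : Computable fun y : List ℕ => y.tail.tail.headI := h1.comp ht
  have h3 : Computable fun y : List ℕ => y.tail.tail.tail.headI := h2.comp ht
  have hS : ComputablePred fun a : List ℕ × ℕ => S a.1 a.2 := by
    refine ComputablePred.exists_lt (p := fun (a : List ℕ × ℕ) i =>
      Φ.step a.2 (numStr i) [a.1.tail.tail.tail.headI] = some [a.1.headI]) ?_ ?_
    · exact Computable.nat_sub (Computable.two_pow (Computable.succ.comp
        (Computable.nat_add (h1.comp Computable.fst) (Computable.const c)))) (Computable.const 1)
    · have hy : Computable fun b : (List ℕ × ℕ) × ℕ => b.1.1 := Computable.fst.comp Computable.fst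
      exact Computable.computablePred_eq (Φ.computable_step.comp (Computable.pair
        (Computable.snd.comp Computable.fst) (Computable.pair
          (Primrec.numStr.to_comp.comp Computable.snd) (Computable.singleton (h3.comp hy)))))
        (Computable.option_some.comp (Computable.singleton (h0.comp hy)))
  have hf : ∀ δ, Partrec (f δ) := fun δ => by
    have hk : Computable fun b : List ℕ × ℕ => 2 ^ b.1.tail.tail.headI :=
      Computable.two_pow (h2.comp Computable.fst)
    refine Partrec.map (Partrec.rfind (p := fun y t => Part.some (decide (S y t))) hS.decide) ?_
    exact Computable.singleton (Computable.nat_add (Computable.nat_sub hk (Computable.const 1))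
      (Computable.nat_mod (Computable.nat_add (Computable.nat_div (Computable.nat_mul
        (Φ.computable_omegaNum.comp (h3.comp Computable.fst) Computable.snd) hk)
        (Computable.two_pow Computable.snd)) (Computable.const δ)) hk))
  choose C hC using fun δ => hΦ.exists_program_le (hf δ)
  refine ⟨C 0 + C 1 + C 2, fun x => ?_⟩
  set n := x.length with hn
  set k := Φ.depth c x with hk
  have hSiff : ∀ t, S [strNum x, Φ.K x, k, n] t ↔
      ∃ p, p.length ≤ Φ.K x + c ∧ Φ.step t p [n] = some [strNum x] := fun t => by
    constructor
    · rintro ⟨i, hi, h⟩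
      exact ⟨numStr i, by rw [length_numStr]; exact natLen_le_iff.2 hi, h⟩
    · rintro ⟨p, hp, h⟩
      refine ⟨strNum p, natLen_le_iff.1 (by rwa [natLen_strNum]), ?_⟩
      rw [numStr_strNum]
      exact h
  obtain ⟨t, htS⟩ : ∃ t, t ∈ Nat.rfind fun t => Part.some (decide (S [strNum x, Φ.K x, k, n] t)) := by
    refine Part.dom_iff_mem.1 (Nat.rfind_dom.2 ⟨Φ.omegaTime n k, ?_, fun _ => trivial⟩)
    obtain ⟨p, hp, hl⟩ := exists_program_depth hΦ c x
    rw [Part.mem_some_iff, eq_comm, decide_eq_true_iff]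
    exact (hSiff _).2 ⟨p, hl, hp⟩
  have hst : S [strNum x, Φ.K x, k, n] t := by
    simpa using Nat.rfind_spec htS
  obtain ⟨p, hpl, hp⟩ := (hSiff t).1 hst
  have hfloor : ⌊2 ^ k * Φ.omegaWithin n t⌋₊ = Φ.omegaNum n t * 2 ^ k / 2 ^ t := by
    rw [← Nat.floor_div_eq_div (K := ℝ), omegaWithin_eq]
    push_cast
    congr 1
    ring
  obtain ⟨δ, hδ, hmod⟩ : ∃ δ ≤ 2, (Φ.omegaNum n t * 2 ^ k / 2 ^ t + δ) % 2 ^ k =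
      ⌊2 ^ k * Φ.omega n⌋₊ % 2 ^ k := by
    rcases hk0 : k with _ | j
    · exact ⟨0, by omega, by simp [Nat.mod_one]⟩
    · rw [← hk0, ← hfloor]
      have hle : 2 ^ k * Φ.omegaWithin n t ≤ 2 ^ k * Φ.omega n :=
        mul_le_mul_of_nonneg_left (omegaWithin_le_omega hΦ.2.1 n t) (by positivity)
      -- Otherwise `p` would print `x` by time `t_{k-1}`, against the minimality of the depth.
      have hjt : Φ.omegaTime n j ≤ t := by
        by_contra! hlt
        exact step_ne_of_lt_depth (by omega) hpl (Φ.step_mono hlt.le hp)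
      have hge : 2 ^ k * Φ.omega n ≤ 2 ^ k * Φ.omegaWithin n t + (2 : ℕ) := by
        have := two_pow_mul_omega_sub_le hjt
        rw [← hk0] at this
        push_cast
        linarith
      have g1 := Nat.floor_mono hle
      have g2 := Nat.floor_mono hge
      rw [Nat.floor_add_natCast (mul_nonneg (by positivity) (Φ.omegaWithin_nonneg n t))] at g2
      refine ⟨⌊2 ^ k * Φ.omega n⌋₊ - ⌊2 ^ k * Φ.omegaWithin n t⌋₊, by omega, ?_⟩
      rw [Nat.add_sub_cancel' g1]
  have hout : [strNum (Φ.omegaBits n k)] ∈ f δ [strNum x, Φ.K x, k, n] := by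
    refine (Part.mem_map_iff _).2 ⟨t, htS, ?_⟩
    have h1 := strNum_omegaBits (Φ := Φ) n k
    have h2 : 0 < 2 ^ k := by positivity
    simp only [List.tail_cons, List.headI_cons, hmod, List.cons.injEq, and_true]
    omega
  obtain ⟨q, hq, hq'⟩ := hC δ _ _ hout
  refine ⟨q, hq.trans ?_, hq'⟩
  interval_cases δ <;> omega

/-- The first `k` bits of `Ω^n`, with a self-delimiting code of `k`, can be put in front of a
program that has them as a condition. -/
theorem exists_K_le_omegaBits (hΦ : IsUniversal ∅ Φ.eval) :
    ∃ C, ∀ (x : List Bool) (k : ℕ), Φ.K x ≤ 2 * natLen k + k +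
      complexity Φ.eval [strNum x] [strNum (Φ.omegaBits x.length k), x.length] + C := by
  obtain ⟨C, hC⟩ := hΦ.exists_complexity_le_header hΦ computable_parseBlock
    (fun p a q r h => parseBlock_append r h) (f := fun a => Part.some (a.1 :: a.2))
    (Partrec.recursiveIn (Computable.list_cons.comp Computable.fst Computable.snd))
  refine ⟨C + 1, fun x k => ?_⟩
  have := hC (natHeader k ++ Φ.omegaBits x.length k) _ [x.length] _ [strNum x]
    (fun q => by
      have h := parseBlock_natHeader (Φ.omegaBits x.length k) q
      rwa [length_omegaBits] at h)
    (Part.mem_some _)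
  rw [List.length_append, length_natHeader, length_omegaBits] at this
  dsimp only at this
  change complexity Φ.eval [strNum x] [x.length] ≤ _
  omega

theorem exists_depth_add_complexity_omegaBits_le (hΦ : IsUniversal ∅ Φ.eval) (c : ℕ) :
    ∃ C, ∀ x : List Bool, Φ.depth c x + complexity Φ.eval [strNum x]
      [strNum (Φ.omegaBits x.length (Φ.depth c x)), x.length] ≤ Φ.K x + C := by
  obtain ⟨C, hC⟩ := exists_complexity_add_depth_le hΦ c
  let f : ℕ → List ℕ → List ℕ := fun e y =>
    [y.tail.headI, natLen y.headI, y.headI + 1 - 2 ^ natLen y.headI + e * 2 ^ natLen y.headI]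
  have hf : ∀ e, Computable (f e) := fun e => by
    have h0 : Computable (List.headI : List ℕ → ℕ) := Primrec.list_headI.to_comp
    have hl : Computable fun y : List ℕ => natLen y.headI := Primrec.natLen.to_comp.comp h0
    exact Computable.list_cons.comp (h0.comp Primrec.list_tail.to_comp) (Computable.list_cons.comp
      hl (Computable.singleton (Computable.nat_add (Computable.nat_sub (Computable.succ.comp h0)
        (Computable.two_pow hl)) (Computable.nat_mul (Computable.const e)
          (Computable.two_pow hl)))))
  choose C' hC' using fun e => hΦ.exists_complexity_le_comp (f := fun y => Part.some (f e y)) (hf e)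
  refine ⟨C + C' 0 + C' 1, fun x => ?_⟩
  set n := x.length with hn
  set k := Φ.depth c x with hk
  have h2k : (0 : ℝ) < 2 ^ k := by positivity
  -- The bits give the integer part only modulo `2^k`; `e = 1` restores the multiple lost when `Ω^n
  -- = 1`.
  obtain ⟨e, he, hm⟩ : ∃ e ≤ 1, ⌊2 ^ k * Φ.omega n⌋₊ % 2 ^ k + e * 2 ^ k = ⌊2 ^ k * Φ.omega n⌋₊ := by
    rcases (omega_le_one hΦ.2.1 n).lt_or_eq with h | h
    · refine ⟨0, by omega, ?_⟩
      rw [zero_mul, add_zero, Nat.mod_eq_of_lt]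
      rw [Nat.floor_lt (mul_nonneg h2k.le (omega_nonneg hΦ.2.1 n))]
      push_cast
      nlinarith
    · refine ⟨1, le_rfl, ?_⟩
      have : ⌊(2 : ℝ) ^ k⌋₊ = 2 ^ k := by exact_mod_cast Nat.floor_natCast (R := ℝ) (2 ^ k)
      rw [h, mul_one, this, Nat.mod_self, one_mul, zero_add]
  have hfe : f e [strNum (Φ.omegaBits n k), n] = [n, k, ⌊2 ^ k * Φ.omega n⌋₊] := by
    have h1 := strNum_omegaBits (Φ := Φ) n k
    simp only [f, List.tail_cons, List.headI_cons, natLen_strNum, length_omegaBits, h1,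
      Nat.add_sub_cancel_left, hm]
  have h1 := hC x ⌊2 ^ k * Φ.omega n⌋₊
    (Nat.floor_le (mul_nonneg h2k.le (omega_nonneg hΦ.2.1 n))) (Nat.lt_floor_add_one _).le
  have h3 := hC' e [strNum (Φ.omegaBits n k), n] _ [strNum x] (Part.mem_some _)
  rw [hfe] at h3
  have h4 : C' e ≤ C' 0 + C' 1 := by interval_cases e <;> omega
  rw [← hk, ← hn] at h1
  omega

/-- Whether `m / 2^k` is reached by some `Ω^n_t` is a halting problem for `Φ`. -/
theorem exists_halting_iff_omegaNum (hΦ : IsUniversal ∅ Φ.eval) :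
    ∃ w : List Bool, ∀ n m k, (Φ.eval (w ++ (List.replicate (Nat.pair m k) false ++ [true]))
      [n]).Dom ↔ ∃ t, m * 2 ^ t ≤ Φ.omegaNum n t * 2 ^ k := by
  classical
  -- The pair is coded in unary as `0^N 1`, which is self-delimiting; its length is irrelevant, as
  -- the program serves only as an oracle query.
  let T : List Bool × List ℕ → ℕ → Prop := fun a t =>
    a.1.idxOf true + 1 = a.1.length ∧ (a.1.length - 1).unpair.1 * 2 ^ t ≤
      Φ.omegaNum a.2.headI t * 2 ^ (a.1.length - 1).unpair.2
  let V : List Bool → List ℕ →. List ℕ := fun q y =>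
    (Nat.rfind fun t => Part.some (decide (T (q, y) t))).map fun _ => []
  have hdom : ∀ q y, (V q y).Dom ↔ ∃ t, T (q, y) t := fun q y => by
    refine Nat.rfind_dom.trans (exists_congr fun t => ?_)
    rw [Part.mem_some_iff, eq_comm, decide_eq_true_iff]
    exact and_iff_left fun _ => trivial
  have hV : RecursiveIn₂ ∅ V := by
    have hq : Computable fun a : (List Bool × List ℕ) × ℕ => a.1.1 :=
      Computable.fst.comp Computable.fst
    have hy : Computable fun a : (List Bool × List ℕ) × ℕ => a.1.2.headI :=
      Primrec.list_headI.to_comp.comp (Computable.snd.comp Computable.fst)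
    have hl : Computable fun a : (List Bool × List ℕ) × ℕ => a.1.1.length :=
      Computable.list_length.comp hq
    have hu : Computable fun a : (List Bool × List ℕ) × ℕ => (a.1.1.length - 1).unpair :=
      Computable.unpair.comp (Computable.nat_sub hl (Computable.const 1))
    have hT : ComputablePred fun a : (List Bool × List ℕ) × ℕ => T a.1 a.2 :=
      ComputablePred.and' (Computable.computablePred_eq (Computable.succ.comp
        (Primrec.list_idxOf.to_comp.comp (Computable.const true) hq)) hl)
        (Computable.computablePred_le (Computable.nat_mul (Computable.fst.comp hu)
          (Computable.two_pow Computable.snd)) (Computable.nat_mul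
            (Φ.computable_omegaNum.comp hy Computable.snd)
            (Computable.two_pow (Computable.snd.comp hu))))
    exact Partrec.recursiveIn (Partrec.map (Partrec.rfind
      (p := fun a t => Part.some (decide (T a t))) hT.decide) (Computable.const []).to₂)
  have hV' : IsPrefixFree V := by
    rintro y p _ h1 h2 ⟨r, rfl⟩
    obtain ⟨t, h1, -⟩ := (hdom _ _).1 h1
    obtain ⟨t', h2, -⟩ := (hdom _ _).1 h2
    simp only at h1 h2
    rw [List.idxOf_append_of_mem (List.idxOf_lt_length_iff.1 (by omega)), List.length_append] at h2
    rw [List.length_eq_zero_iff.1 (show r.length = 0 by omega), List.append_nil]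
  obtain ⟨w, hw⟩ := hΦ.2.2 V hV hV'
  refine ⟨w, fun n m k => ?_⟩
  rw [hw, hdom]
  refine exists_congr fun t => ?_
  simp only [T, idxOf_replicate_false, List.length_append, List.length_replicate,
    List.length_singleton, Nat.add_sub_cancel, Nat.unpair_pair, true_and, List.headI_cons]

theorem halting_pair_eq_zero_iff {n : ℕ} {p : List Bool} :
    Φ.halting (Nat.pair n (strNum p)) = 0 ↔ ¬ (Φ.eval p [n]).Dom := by
  have h : (∃ q : List Bool, strNum q = strNum p ∧ (Φ.eval q [n]).Dom) ↔ (Φ.eval p [n]).Dom :=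
    ⟨fun ⟨q, hq, h⟩ => strNum_injective hq ▸ h, fun h => ⟨p, rfl, h⟩⟩
  rw [← h, halting]
  split_ifs with h' <;> simpa only [Nat.unpair_pair, one_ne_zero, not_not, false_iff, true_iff] using h'

/-- The halting sequence computes approximations of `Ω^n`. -/
theorem exists_recursiveIn_omega_approx (hΦ : IsUniversal ∅ Φ.eval) :
    ∃ μ : ℕ →. ℕ, RecursiveIn {fun m => Part.some (Φ.halting m)} μ ∧
      ∀ n k, ∃ m ∈ μ (Nat.pair n k), m ≤ 2 ^ k * Φ.omega n ∧ 2 ^ k * Φ.omega n ≤ m + 1 := by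
  obtain ⟨w, hw⟩ := exists_halting_iff_omegaNum hΦ
  let query : ℕ → ℕ := fun b => Nat.pair b.unpair.1.unpair.1 (strNum (w ++ (List.replicate
    (Nat.pair (b.unpair.2 + 1) b.unpair.1.unpair.2) false ++ [true])))
  have hquery : Computable query := by
    have hrep : Primrec fun N : ℕ => List.replicate N false :=
      (Primrec.list_map Primrec.list_range (Primrec.const false).to₂).of_eq fun N => by simp
    have h1 : Primrec fun b : ℕ => b.unpair.1.unpair :=
      Primrec.unpair.comp (Primrec.fst.comp Primrec.unpair)
    exact (Primrec₂.natPair.comp (Primrec.fst.comp h1) (Primrec.strNum.comp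
      (Primrec.list_append.comp (Primrec.const w) (Primrec.list_concat.comp (hrep.comp
        (Primrec₂.natPair.comp (Primrec.succ.comp (Primrec.snd.comp Primrec.unpair))
          (Primrec.snd.comp h1))) (Primrec.const true))))).to_comp
  have horacle : RecursiveIn {fun m => Part.some (Φ.halting m)}
      fun m => Part.some (Φ.halting m) := RecursiveIn.oracle _ rfl
  -- The search finds the least `m` such that no `Ω^n_t` reaches `(m + 1)/2^k`; it stops by `m =
  -- 2^k` because `Ω^n ≤ 1`.
  have hrf := Nat.RecursiveIn.rfind (RecursiveIn.iff_nat.1 (horacle.comp' hquery))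
  refine ⟨_, RecursiveIn.iff_nat.2 hrf, fun n k => ?_⟩
  have hzero : ∀ j, (true ∈ ((fun m => decide (m = 0)) <$>
      (Part.some (Φ.halting (query (Nat.pair (Nat.pair n k) j))) : Part ℕ) : Part Bool)) ↔
      ¬ ∃ t, (j + 1) * 2 ^ t ≤ Φ.omegaNum n t * 2 ^ k := fun j => by
    rw [← hw n (j + 1) k, ← halting_pair_eq_zero_iff]
    simp [query, eq_comm]
  have h2k : (0 : ℝ) < 2 ^ k := by positivity
  have hle : ∀ t, 2 ^ k * Φ.omegaWithin n t ≤ 2 ^ k * Φ.omega n := fun t =>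
    mul_le_mul_of_nonneg_left (omegaWithin_le_omega hΦ.2.1 n t) h2k.le
  let test : ℕ →. Bool := fun j => (fun m => decide (m = 0)) <$>
    (Part.some (Φ.halting (query (Nat.pair (Nat.pair n k) j))) : Part ℕ)
  obtain ⟨m, hm⟩ : ∃ m, m ∈ Nat.rfind test := by
    refine Part.dom_iff_mem.1 (Nat.rfind_dom.2 ⟨2 ^ k, (hzero (2 ^ k)).2 ?_, fun {j} _ => trivial⟩)
    rintro ⟨t, ht⟩
    have h1 := (Φ.mul_two_pow_le_omegaNum_iff.1 ht).trans (hle t)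
    have h2 := mul_le_mul_of_nonneg_left (omega_le_one hΦ.2.1 n) h2k.le
    push_cast at h1
    linarith
  refine ⟨m, hm, ?_, ?_⟩
  · rcases m with _ | j
    · simpa using mul_nonneg h2k.le (omega_nonneg hΦ.2.1 n)
    · have h1 := Nat.rfind_min hm (Nat.lt_succ_self j)
      have h2 : ∃ t, (j + 1) * 2 ^ t ≤ Φ.omegaNum n t * 2 ^ k := by
        by_contra h
        exact Bool.false_ne_true (Part.mem_unique h1 ((hzero j).2 h))
      obtain ⟨t, ht⟩ := h2
      exact (Φ.mul_two_pow_le_omegaNum_iff.1 ht).trans (hle t)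
  · have h1 := (hzero m).1 (Nat.rfind_spec hm)
    rw [mul_comm, ← le_div_iff₀ h2k]
    refine ciSup_le fun t => ?_
    rw [le_div_iff₀ h2k, mul_comm]
    by_contra! hlt
    exact h1 ⟨t, Φ.mul_two_pow_le_omegaNum_iff.2 (by push_cast; exact hlt.le)⟩

/-- The halting sequence has much information about strings of large depth. -/
theorem exists_depth_le_haltingInfo (hΦ : IsUniversal ∅ Φ.eval)
    {ΦH : List Bool → List ℕ →. List ℕ}
    (hΦH : IsUniversal {fun m => Part.some (Φ.halting m)} ΦH) (c : ℕ) :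
    ∃ C, ∀ x : List Bool, Φ.depth c x + complexity ΦH [strNum x] [x.length] ≤
      Φ.K x + 2 * natLen (Φ.depth c x) + C := by
  obtain ⟨C, hC⟩ := exists_complexity_add_depth_le hΦ c
  obtain ⟨μ, hμ, hμ'⟩ := exists_recursiveIn_omega_approx hΦ
  let f : ℕ × List ℕ →. List ℕ := fun a =>
    ((μ (Nat.pair a.2.headI a.1)).map (Prod.mk a)).bind fun b =>
      Part.some [b.1.2.headI, b.1.1, b.2]
  have hf : RecursiveIn {fun m => Part.some (Φ.halting m)} f := by
    have h0 : Computable (List.headI : List ℕ → ℕ) := Primrec.list_headI.to_comp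
    have h1 : Computable fun a : ℕ × List ℕ => Nat.pair a.2.headI a.1 :=
      Primrec₂.natPair.to_comp.comp (h0.comp Computable.snd) Computable.fst
    have h2 : Computable fun b : (ℕ × List ℕ) × ℕ => [b.1.2.headI, b.1.1, b.2] :=
      Computable.list_cons.comp (h0.comp (Computable.snd.comp Computable.fst))
        (Computable.list_cons.comp (Computable.fst.comp Computable.fst)
          (Computable.singleton Computable.snd))
    exact ((hμ.comp' h1).map_pair Computable.id).bind' h2.computableIn
  obtain ⟨C', hC'⟩ := hΦH.exists_complexity_le_header hΦ computable_parseNat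
    (fun p a q r h => parseNat_append r h) hf
  refine ⟨C + C' + 1, fun x => ?_⟩
  obtain ⟨m, hm, hm1, hm2⟩ := hμ' x.length (Φ.depth c x)
  have h1 := hC x m hm1 hm2
  have h2 := hC' (natHeader (Φ.depth c x)) _ [x.length] [x.length, Φ.depth c x, m] [strNum x]
    (parseNat_natHeader _)
    (Part.mem_bind_iff.2 ⟨_, (Part.mem_map_iff _).2 ⟨m, hm, rfl⟩, Part.mem_some _⟩)
  rw [length_natHeader] at h2
  omega

end Interpreter

theorem proposition3p3 (Φ : Interpreter) (hΦ : IsUniversal ∅ Φ.eval)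
    (ΦH : List Bool → List ℕ →. List ℕ)
    (hΦH : IsUniversal {fun m => Part.some (Φ.halting m)} ΦH) (c : ℕ) :
    ∃ C : ℕ, ∀ (n : ℕ) (x : List Bool), x.length = n →
      Φ.Computes C n [strNum x, Φ.K x, Φ.depth c x] [strNum (Φ.omegaBits n (Φ.depth c x))] ∧
      |(Φ.K x : ℤ) - ((Φ.depth c x : ℤ) +
          (complexity Φ.eval [strNum x] [strNum (Φ.omegaBits n (Φ.depth c x)), n] : ℤ))|
        ≤ 2 * (natLen (Φ.depth c x) : ℤ) + (C : ℤ) ∧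
      Φ.haltingInfo ΦH x ≥ (Φ.depth c x : ℤ) - 2 * (natLen (Φ.depth c x) : ℤ) - (C : ℤ) := by
  obtain ⟨C₁, h₁⟩ := Interpreter.exists_computes_omegaBits hΦ c
  obtain ⟨C₂, h₂⟩ := Interpreter.exists_K_le_omegaBits hΦ
  obtain ⟨C₃, h₃⟩ := Interpreter.exists_depth_add_complexity_omegaBits_le hΦ c
  obtain ⟨C₄, h₄⟩ := Interpreter.exists_depth_le_haltingInfo hΦ hΦH c
  refine ⟨C₁ + C₂ + C₃ + C₄, ?_⟩
  rintro _ x rfl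
  obtain ⟨p, hp, hp'⟩ := h₁ x
  have h₂ := h₂ x (Φ.depth c x)
  have h₃ := h₃ x
  have h₄ := h₄ x
  refine ⟨⟨p, by omega, hp'⟩, ?_, ?_⟩
  · rw [abs_le]
    constructor <;> omega
  · rw [Interpreter.haltingInfo]
    omega
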